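/- Let $\Omega\subset\mathbb C$ be a bounded domain and let $\lambda\in\partial\Omega$ be a smooth real analytic boundary point, i.e. there are a neighbourhood $V$ of $\lambda$ and a real analytic function $\rho:V\to\mathbb R$ with $d\rho(\lambda)\neq0$ and $\partial\Omega\cap V=\{p\in V:\rho(p)=0\}$. Then there exist a connected open neighbourhood $U$ of $\lambda$ on which the Schwarz reflection $w\mapsto w^*$ is defined (the unique anti-analytic function on $U$ with $w^*=w$ for $w\in U\cap\partial\Omega$), an analytic branch of $\log$ on the plane cut along a closed ray from $0$ whose domain contains $z-w^*$ for all $z,w\in U\setminus\overline\Omega$, and an analytic function $a$ on $U\times\{\overline w: w\in U\}$, such that $$\frac{-1}{2\pi i}\int_\Omega\frac{d\overline\zeta\wedge d\zeta}{(\zeta-z)(\overline\zeta-\overline w)}=\log(z-w^*)+a(z,\overline w)\qquad(z,w\in U\setminus\overline\Omega),$$ where the integral is absolutely convergent. Here $d\overline\zeta\wedge d\zeta=2i\,dA$, with $dA$ the planar Lebesgue measure. -/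

import Mathlib

open MeasureTheory Topology Filter
open scoped ComplexConjugate

noncomputable section

/-- Near `lam`, the boundary of `Om` is a smooth real analytic curve: it is the zero set of a
real analytic function whose differential does not vanish at `lam`. -/
def IsSmoothAnalyticBoundaryPoint (Om : Set ℂ) (lam : ℂ) : Prop :=
  lam ∈ frontier Om ∧
    ∃ rho : ℂ → ℝ, AnalyticAt ℝ rho lam ∧ fderiv ℝ rho lam ≠ 0 ∧
      ∀ᶠ p in 𝓝 lam, p ∈ frontier Om ↔ rho p = 0

/-- `sig` is the Schwarz reflection `w ↦ w*` of the set `Gam` on the connected open set `U`: it is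
anti-analytic on `U` and fixes the points of `Gam ∩ U`. (If `Gam ∩ U` contains a non-trivial
curve, `sig` is unique on `U` by the identity theorem.) -/
structure IsSchwarzReflection (Gam U : Set ℂ) (sig : ℂ → ℂ) : Prop where
  isOpen : IsOpen U
  isConnected : IsConnected U
  antianalytic : AnalyticOnNhd ℂ (fun w => conj (sig w)) U
  fixes : ∀ w ∈ Gam ∩ U, sig w = w

/-- The function `ζ ↦ 1 / ((ζ - z) (conj ζ - conj w))`. -/
def cauchyKernel (z w ζ : ℂ) : ℂ := 1 / ((ζ - z) * (conj ζ - conj w))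

/-- The integral over `Om` of the 2-form `f(ζ) d(conj ζ) ∧ dζ`; here `volume` is the planar
Lebesgue measure `dA = dx dy`, and `d(conj ζ) ∧ dζ = (dx - i dy) ∧ (dx + i dy) = 2 i dA`. -/
def integralConjWedge (Om : Set ℂ) (f : ℂ → ℂ) : ℂ :=
  ∫ ζ in Om, f ζ * (2 * Complex.I)

/-- The double Cauchy integral
`(-1 / (2 π i)) ∫_Om d(conj ζ) ∧ dζ / ((ζ - z) (conj ζ - conj w))`. -/
def logPotential (Om : Set ℂ) (z w : ℂ) : ℂ :=
  (-1 / (2 * (Real.pi : ℂ) * Complex.I)) * integralConjWedge Om (cauchyKernel z w)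

/-- The plane cut along the closed ray from `0` in the direction opposite to `e^{i θ}`. -/
def cutPlane (θ : ℝ) : Set ℂ :=
  {v | Complex.exp (-(θ * Complex.I)) * v ∈ Complex.slitPlane}

/-- The analytic branch on `cutPlane θ` of the logarithm, with imaginary part in
`(θ - π, θ + π)` there. -/
def logBranch (θ : ℝ) (v : ℂ) : ℂ :=
  Complex.log (Complex.exp (-(θ * Complex.I)) * v) + θ * Complex.I

end

/-! A holomorphic chart Φ straightens the boundary near λ, carrying the real axis to ∂Ω, so that w*
= Φ(conj Φ⁻¹(w)). If both half-discs go into Ω, no exterior point is near λ and nothing remains to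
prove. Otherwise, after ω ↦ -ω if necessary, the lower half-disc goes into Ω and the upper one
outside its closure.

The part of the integral away from λ is analytic in (z, conj w). The rest, pulled back by Φ, is an
integral over the lower half of a square of p(ω) q(conj ω), where p = Φ'/(Φ - z), q = Ψ'/(Ψ - conj
w) and Ψ(u) = conj Φ(conj u). Write z = Φ(α) and conj w = Ψ(b), with α above the real axis and b
below it. Above b, q has a primitive L, a branch of log(Ψ - Ψ(b)) up to a constant. Stokes turns the
area integral into a boundary integral of p(ω)(L(conj ω) - L(α)). On the real side conj ω = ω, and
p(L - L(α)) is holomorphic above it because the zero of L - L(α) cancels the pole of p; Cauchy moves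
this side to the upper three sides of the square (`NearlyLinear.integral_lower_half`).

What remains lives on the boundary of the full square, far from α and b, and is analytic in both
parameters (`NearlyLinear.analyticOnNhd_capInt_log`, by Osgood's lemma), apart from the constant
L(α) multiplied by the residue 2πi of p (`NearlyLinear.capInt_sub_capInt`). This gives the logarithm
of Ψ(α) - Ψ(b). It differs from that of z - w* = Φ(α) - Φ(b) by the logarithm of a nonvanishing
analytic quotient (`NearlyLinear.exists_log_sub_log`). -/

noncomputable section

/-! ### Straightening the boundary by a holomorphic chart -/

/-- A real analytic curve in `ℂ` extends to a holomorphic function of a complex variable. -/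
theorem exists_complexification {γ : ℝ → ℂ} (h : AnalyticAt ℝ γ 0) :
    ∃ Φ : ℂ → ℂ, AnalyticAt ℂ Φ 0 ∧ ∀ᶠ x : ℝ in 𝓝 0, Φ x = γ x := by
  obtain ⟨p, R, hp⟩ := h
  -- The same Taylor coefficients, read as a complex power series; the norms agree termwise, so the
  -- radius does not shrink.
  let q : FormalMultilinearSeries ℂ ℂ ℂ :=
    fun n => ContinuousMultilinearMap.mkPiRing ℂ (Fin n) (p.coeff n)
  have hq : p.radius ≤ q.radius := by
    refine ENNReal.le_of_forall_nnreal_lt fun s hs => ?_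
    obtain ⟨C, -, hC⟩ := p.norm_mul_pow_le_of_lt_radius hs
    refine q.le_radius_of_bound C fun n => ?_
    have : ‖q n‖ = ‖p n‖ := by
      rw [p.norm_apply_eq_norm_coef]
      exact ContinuousMultilinearMap.norm_mkPiRing (𝕜 := ℂ) (ι := Fin n) (p.coeff n)
    rw [this]
    exact hC n
  have hpos : 0 < q.radius := (hp.r_pos.trans_le hp.r_le).trans_le hq
  refine ⟨q.sum, (q.hasFPowerSeriesOnBall hpos).analyticAt, ?_⟩
  filter_upwards [Metric.eball_mem_nhds (0 : ℝ) hp.r_pos] with x hx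
  have h1 := hp.hasSum hx
  have h2 : ∀ n, p n (fun _ => x) = q n (fun _ => (x : ℂ)) := by
    intro n
    rw [FormalMultilinearSeries.apply_eq_pow_smul_coeff]
    simp [q]
  simp only [h2, zero_add] at h1
  exact h1.tsum_eq

/-- The real analytic inverse function theorem parametrizes the curve `rho = 0`; the complexified
parametrization is a conformal map, and its injectivity shows that only real parameters reach the
boundary. -/
theorem exists_boundary_chart {Om : Set ℂ} {lam : ℂ}
    (h : IsSmoothAnalyticBoundaryPoint Om lam) :
    ∃ Φ : ℂ → ℂ, AnalyticAt ℂ Φ 0 ∧ Φ 0 = lam ∧ deriv Φ 0 ≠ 0 ∧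
      ∀ᶠ ω in 𝓝 0, (Φ ω ∈ frontier Om ↔ ω.im = 0) := by
  obtain ⟨hlam, rho, hrho, hD, hloc⟩ := h
  set D := fderiv ℝ rho lam with hDdef
  have hrho0 : rho lam = 0 := hloc.self_of_nhds.1 hlam
  -- The real part is a coordinate along the tangent and the imaginary part is `rho`. As `D ≠ 0`, `D
  -- p` and `D (I * p)` vanish together only at `p = 0`, so `F` is a local diffeomorphism.
  let F : ℂ → ℂ := fun p => (D (Complex.I * (p - lam)) : ℂ) + Complex.I * (rho p : ℂ)
  let A : ℂ →L[ℝ] ℂ :=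
    Complex.ofRealCLM ∘L D ∘L (ContinuousLinearMap.mul ℝ ℂ Complex.I) +
      (ContinuousLinearMap.mul ℝ ℂ Complex.I) ∘L Complex.ofRealCLM ∘L D
  have hAapp : ∀ p, A p = (D (Complex.I * p) : ℂ) + Complex.I * (D p : ℂ) := fun p => by simp [A]
  have hAinj : Function.Injective A := by
    refine (injective_iff_map_eq_zero A).2 fun p hp => ?_
    rw [hAapp] at hp
    have h1 : D (Complex.I * p) = 0 := by simpa using congrArg Complex.re hp
    have h2 : D p = 0 := by simpa using congrArg Complex.im hp
    by_contra hp0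
    apply hD
    ext w
    have : w = (w / p).re • p + (w / p).im • (Complex.I * p) := by
      rw [Complex.real_smul, Complex.real_smul, ← mul_assoc, ← add_mul, Complex.re_add_im,
        div_mul_cancel₀ _ hp0]
    rw [this, map_add, map_smul, map_smul, h1, h2]
    simp
  let Ae : ℂ ≃L[ℝ] ℂ := (LinearEquiv.ofInjectiveEndo A.toLinearMap hAinj).toContinuousLinearEquiv
  have hAe : (Ae : ℂ →L[ℝ] ℂ) = A := by ext; rfl
  have hFan : AnalyticAt ℝ F lam := by
    have h1 : AnalyticAt ℝ (fun p : ℂ => Complex.ofRealCLM (D (Complex.I * (p - lam)))) lam := by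
      refine (Complex.ofRealCLM.analyticAt _).comp ((D.analyticAt _).comp ?_)
      fun_prop
    have h2 : AnalyticAt ℝ (fun p : ℂ => Complex.ofRealCLM (rho p)) lam :=
      (Complex.ofRealCLM.analyticAt _).comp hrho
    exact h1.add (analyticAt_const.mul h2)
  have hFd : HasFDerivAt F A lam := by
    have h1 : HasFDerivAt (fun p : ℂ => Complex.I * (p - lam))
        (ContinuousLinearMap.mul ℝ ℂ Complex.I) lam :=
      (ContinuousLinearMap.mul ℝ ℂ Complex.I).hasFDerivAt.comp lam
        ((hasFDerivAt_id lam).sub_const lam)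
    have h2 : HasFDerivAt rho D lam := hrho.differentiableAt.hasFDerivAt
    have h3 := (Complex.ofRealCLM.hasFDerivAt (x := D (Complex.I * (lam - lam)))).comp lam
      ((D.hasFDerivAt (x := Complex.I * (lam - lam))).comp lam h1)
    have h4 := (ContinuousLinearMap.mul ℝ ℂ Complex.I).hasFDerivAt.comp lam
      ((Complex.ofRealCLM.hasFDerivAt (x := rho lam)).comp lam h2)
    exact h3.add h4
  have hFs : HasStrictFDerivAt F (Ae : ℂ →L[ℝ] ℂ) lam := by
    have := hFan.hasStrictFDerivAt
    rwa [hFd.fderiv, ← hAe] at this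
  have hF0 : F lam = 0 := by simp [F, hrho0]
  set e := hFs.toOpenPartialHomeomorph F with he
  have hmem : lam ∈ e.source := hFs.mem_toOpenPartialHomeomorph_source
  have hecoe : (e : ℂ → ℂ) = F := rfl
  have h0t : (0 : ℂ) ∈ e.target := by rw [← hF0]; exact e.map_source hmem
  have hes : e.symm 0 = lam := by
    rw [← hF0]; exact e.left_inv hmem
  have hesan : AnalyticAt ℝ e.symm 0 := by
    rw [← hF0]
    exact e.analyticAt_symm' (i := Ae) hmem hFan (by rw [hecoe, hFd.fderiv, hAe])
  let γ : ℝ → ℂ := fun x => e.symm (x : ℂ)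
  have hγan : AnalyticAt ℝ γ 0 := by
    have : AnalyticAt ℝ e.symm (Complex.ofRealCLM 0) := by simpa using hesan
    exact this.comp (Complex.ofRealCLM.analyticAt 0)
  have hγ0 : γ 0 = lam := by simp [γ, hes]
  have hofR : Tendsto (fun x : ℝ => (x : ℂ)) (𝓝 0) (𝓝 0) := by
    simpa using Complex.continuous_ofReal.tendsto 0
  have hFγ : ∀ᶠ x : ℝ in 𝓝 0, F (γ x) = x := by
    filter_upwards [hofR (e.open_target.mem_nhds h0t)] with x hx using e.right_inv hx
  obtain ⟨Φ, hΦ, hΦγ⟩ := exists_complexification hγan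
  have hΦ0 : Φ 0 = lam := by simpa [hγ0] using hΦγ.self_of_nhds
  -- `F ∘ Φ` is the identity on small reals, which a vanishing derivative would forbid.
  have hΦd : deriv Φ 0 ≠ 0 := by
    intro h0
    have h1 : HasDerivAt Φ 0 ((0 : ℝ) : ℂ) := by
      rw [← h0]; simpa using hΦ.differentiableAt.hasDerivAt
    have h2 : HasDerivAt (fun x : ℝ => Φ x) 0 0 := by
      simpa using h1.comp_ofReal
    have h3 : HasDerivAt (fun x : ℝ => F (Φ x)) (A 0) 0 := by
      have : HasFDerivAt F A (Φ ((0 : ℝ) : ℂ)) := by simpa [hΦ0] using hFd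
      exact this.comp_hasDerivAt 0 h2
    have h4 : HasDerivAt (fun x : ℝ => (x : ℂ)) (A 0) 0 := by
      refine h3.congr_of_eventuallyEq ?_
      filter_upwards [hΦγ, hFγ] with x hx1 hx2
      rw [hx1, hx2]
    have h5 : HasDerivAt (fun x : ℝ => (x : ℂ)) 1 0 := Complex.ofRealCLM.hasDerivAt
    have := h4.unique h5
    simp at this
  refine ⟨Φ, hΦ, hΦ0, hΦd, ?_⟩
  obtain ⟨N, hN, hinj⟩ : ∃ N ∈ 𝓝 (0 : ℂ), Set.InjOn Φ N := by
    have hs : HasStrictDerivAt Φ (deriv Φ 0) 0 := hΦ.hasStrictDerivAt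
    let e' := (hs.hasStrictFDerivAt_equiv hΦd).toOpenPartialHomeomorph Φ
    exact ⟨e'.source, e'.open_source.mem_nhds
      (hs.hasStrictFDerivAt_equiv hΦd).mem_toOpenPartialHomeomorph_source, e'.injOn⟩
  have hΦt : Tendsto Φ (𝓝 0) (𝓝 lam) := hΦ0 ▸ hΦ.continuousAt.tendsto
  -- The only possible real parameter of the point `Φ ω`: if `rho` vanishes there, then `Φ ω = Φ (x
  -- ω)`, and injectivity makes `ω` real.
  let x : ℂ → ℝ := fun ω => D (Complex.I * (Φ ω - lam))
  have hxt : Tendsto x (𝓝 0) (𝓝 0) := by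
    have : ContinuousAt x 0 := by
      have := hΦ.continuousAt
      fun_prop
    simpa [ContinuousAt, x, hΦ0] using this
  have hre : Tendsto Complex.re (𝓝 0) (𝓝 0) := by simpa using Complex.continuous_re.tendsto 0
  filter_upwards [hΦt.eventually hloc, hΦt (e.open_source.mem_nhds hmem), hN,
    hxt.eventually hΦγ, (hofR.comp hxt) hN, hre.eventually hΦγ, hre.eventually hFγ]
    with ω h1 h2 h3 h4 h5 h6 h7
  rw [h1]
  constructor
  · intro hr
    have hFx : F (Φ ω) = (x ω : ℂ) := by simp [F, x, hr]
    have : Φ ω = Φ (x ω) := by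
      rw [h4, ← e.left_inv h2]
      simp only [γ]
      rw [← hFx]
      rfl
    rw [hinj h3 h5 this]
    simp
  · intro him
    have hω : (ω.re : ℂ) = ω := Complex.ext rfl (by simp [him])
    have : F (Φ ω) = ω.re := by rw [← h7, ← h6, hω]
    have := congrArg Complex.im this
    simpa [F] using this

/-! ### Analytic dependence of integrals on parameters -/

/-- Currying. It turns an integral with parameters into a continuous functional applied to a map
into a space of continuous functions. -/
theorem exists_continuousOn_continuousMap {P X E : Type*} [TopologicalSpace P]
    [TopologicalSpace X] [NormedAddCommGroup E] {W : Set P} {f : P → X → E}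
    (hf : ContinuousOn (Function.uncurry f) (W ×ˢ Set.univ)) :
    ∃ G : P → C(X, E), ContinuousOn G W ∧ ∀ p ∈ W, ∀ x, G p x = f p x := by
  classical
  let F : C(W × X, E) := ⟨fun q => f q.1 q.2,
    hf.comp_continuous (f := fun q : W × X => ((q.1 : P), q.2)) (by fun_prop)
      fun q => ⟨q.1.2, trivial⟩⟩
  let G : P → C(X, E) := fun p => if h : p ∈ W then F.curry ⟨p, h⟩ else 0
  have hG : ∀ p (h : p ∈ W), G p = F.curry ⟨p, h⟩ := fun p h => dif_pos h
  refine ⟨G, ?_, fun p hp x => by rw [hG p hp]; rfl⟩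
  rw [continuousOn_iff_continuous_domRestrict]
  have : W.domRestrict G = F.curry := by
    funext p
    exact hG p p.2
  rw [this]
  exact F.curry.continuous

/-- A continuous family of continuous functions on a compact space which is pointwise holomorphic
is holomorphic for the uniform norm. -/
theorem differentiableOn_continuousMap {X : Type*} [TopologicalSpace X] [CompactSpace X]
    {s : Set ℂ} (hs : IsOpen s) {G : ℂ → C(X, ℂ)} (hG : ContinuousOn G s)
    (hd : ∀ x, DifferentiableOn ℂ (fun z => G z x) s) : DifferentiableOn ℂ G s := by
  intro z₀ hz₀
  obtain ⟨R, hR, hball⟩ := Metric.nhds_basis_closedBall.mem_iff.1 (hs.mem_nhds hz₀)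
  lift R to NNReal using hR.le
  have hc : ContinuousOn G (Metric.sphere z₀ R) :=
    hG.mono (Metric.sphere_subset_closedBall.trans hball)
  have hci : CircleIntegrable G z₀ R := hc.circleIntegrable R.2
  have hps := hasFPowerSeriesOn_cauchy_integral hci (by exact_mod_cast hR)
  -- Cauchy's formula for `G` itself: evaluation at `x` commutes with the contour integral, so the
  -- scalar formula at each `x` suffices. The Cauchy integral then has a power series.
  have heq : ∀ w ∈ Metric.ball z₀ R,
      (2 * Real.pi * Complex.I : ℂ)⁻¹ • (∮ ξ in C(z₀, R), (ξ - w)⁻¹ • G ξ) = G w := by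
    intro w hw
    ext x
    have h1 := (((hd x).mono hball).diffContOnCl_ball (U := Metric.closedBall z₀ R)
      subset_rfl).two_pi_i_inv_smul_circleIntegral_sub_inv_smul hw
    rw [← h1, ContinuousMap.smul_apply]
    congr 1
    have hci2 : CircleIntegrable (fun ξ => (ξ - w)⁻¹ • G ξ) z₀ R := by
      have hinv : ContinuousOn (fun ξ : ℂ => (ξ - w)⁻¹) (Metric.sphere z₀ R) := ?_
      · exact ContinuousOn.circleIntegrable R.2 (hinv.smul hc)
      refine ContinuousOn.inv₀ (by fun_prop) fun ξ hξ h0 => ?_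
      rw [sub_eq_zero] at h0
      subst h0
      exact (Metric.sphere_disjoint_ball).le_bot ⟨hξ, hw⟩
    have := (ContinuousMap.evalCLM ℂ x : C(X, ℂ) →L[ℂ] ℂ).intervalIntegral_comp_comm hci2.out
    exact this.symm
  have hev : (fun w => (2 * Real.pi * Complex.I : ℂ)⁻¹ • (∮ ξ in C(z₀, R), (ξ - w)⁻¹ • G ξ))
      =ᶠ[𝓝 z₀] G := by
    filter_upwards [Metric.ball_mem_nhds z₀ hR] with w hw using heq w hw
  exact (hps.analyticAt.differentiableAt.congr_of_eventuallyEq hev.symm).differentiableWithinAt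

/-- Integration over a compact set, as a functional on the continuous functions on it. -/
theorem exists_setIntegral_clm {X : Type*} [TopologicalSpace X] [T2Space X] [MeasurableSpace X]
    [BorelSpace X] {K : Set X} (hK : IsCompact K) (μ : Measure X) [IsFiniteMeasureOnCompacts μ] :
    ∃ Λ : C(K, ℂ) →L[ℂ] ℂ, ∀ (k : C(K, ℂ)) (f : X → ℂ), (∀ x : K, k x = f x) →
      Λ k = ∫ x in K, f x ∂μ := by
  have : CompactSpace K := isCompact_iff_compactSpace.1 hK
  have hm : MeasurableSet K := hK.measurableSet
  let ν : Measure K := μ.comap Subtype.val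
  have : IsFiniteMeasure ν := ⟨by
    rw [(MeasurableEmbedding.subtype_coe hm).comap_apply, Set.image_univ, Subtype.range_coe]
    exact hK.measure_lt_top⟩
  have hint : ∀ k : C(K, ℂ), Integrable k ν := fun k =>
    k.continuous.integrable_of_hasCompactSupport (HasCompactSupport.of_compactSpace _)
  let Λ : C(K, ℂ) →ₗ[ℂ] ℂ :=
    { toFun := fun k => ∫ x, k x ∂ν
      map_add' := fun k l => integral_add (hint k) (hint l)
      map_smul' := fun c k => integral_const_mul c _ }
  refine ⟨Λ.mkContinuous (ν.real Set.univ) fun k => ?_, fun k f hkf => ?_⟩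
  · have := norm_integral_le_of_norm_le_const (μ := ν) (f := k) (C := ‖k‖)
      (Eventually.of_forall fun x => k.norm_coe_le_norm x)
    rw [mul_comm]
    exact this
  · change ∫ x, k x ∂ν = _
    rw [← integral_subtype_comap hm]
    exact integral_congr_ae (Eventually.of_forall hkf)

/-- **Osgood's lemma** in two variables. -/
theorem analyticOnNhd_of_separately {f : ℂ × ℂ → ℂ} {W : Set (ℂ × ℂ)} (hW : IsOpen W)
    (hf : ContinuousOn f W) (h1 : ∀ p ∈ W, DifferentiableAt ℂ (fun z => f (z, p.2)) p.1)
    (h2 : ∀ p ∈ W, DifferentiableAt ℂ (fun v => f (p.1, v)) p.2) : AnalyticOnNhd ℂ f W := by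
  rintro ⟨z₀, v₀⟩ hp
  obtain ⟨R, hR, hball⟩ := Metric.nhds_basis_closedBall.mem_iff.1 (hW.mem_nhds hp)
  have hmem : ∀ z ∈ Metric.closedBall z₀ R, ∀ v ∈ Metric.closedBall v₀ R, (z, v) ∈ W := by
    intro z hz v hv
    apply hball
    rw [← closedBall_prod_same]
    exact ⟨hz, hv⟩
  let K : Set ℝ := Set.Icc 0 (2 * Real.pi)
  have : CompactSpace K := isCompact_iff_compactSpace.1 isCompact_Icc
  obtain ⟨Λ, hΛ⟩ := exists_setIntegral_clm (K := K) isCompact_Icc (volume : Measure ℝ)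
  have hcirc : ∀ θ : ℝ, circleMap v₀ R θ ∈ Metric.closedBall v₀ R := fun θ =>
    Metric.sphere_subset_closedBall (circleMap_mem_sphere _ hR.le _)
  -- Cauchy's formula in `v` reads `f (z, v) = (2πi)⁻¹ Λ (H v * G z)`. The variables are now
  -- separated, each factor being a holomorphic function of one variable with values in `C(K, ℂ)`,
  -- so the product is jointly analytic.
  obtain ⟨G, hGc, hG⟩ := exists_continuousOn_continuousMap (P := ℂ) (X := K)
    (W := Metric.ball z₀ R)
    (f := fun z θ => deriv (circleMap v₀ R) θ * f (z, circleMap v₀ R θ)) (by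
      refine ContinuousOn.mul ?_ (hf.comp ?_ ?_)
      · simp only [deriv_circleMap]
        fun_prop
      · fun_prop
      · rintro ⟨z, θ⟩ hz
        exact hmem _ (Metric.ball_subset_closedBall hz.1) _ (hcirc θ))
  obtain ⟨H, hHc, hH⟩ := exists_continuousOn_continuousMap (P := ℂ) (X := K)
    (W := Metric.ball v₀ R) (f := fun v θ => (circleMap v₀ R θ - v)⁻¹) (by
      refine ContinuousOn.inv₀ (by fun_prop) ?_
      rintro ⟨v, θ⟩ hv h0
      simp only [sub_eq_zero] at h0
      have h1 := circleMap_mem_sphere v₀ hR.le θ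
      rw [h0] at h1
      exact (Metric.sphere_disjoint_ball).le_bot ⟨h1, hv.1⟩)
  have hGd : DifferentiableOn ℂ G (Metric.ball z₀ R) := by
    refine differentiableOn_continuousMap Metric.isOpen_ball hGc fun θ => ?_
    refine DifferentiableOn.congr (f := fun z => deriv (circleMap v₀ R) θ *
      f (z, circleMap v₀ R θ)) (fun z hz => ?_) fun z hz => hG z hz θ
    exact ((h1 (z, circleMap v₀ R θ) (hmem _ (Metric.ball_subset_closedBall hz) _
      (hcirc θ))).const_mul _).differentiableWithinAt
  have hHd : DifferentiableOn ℂ H (Metric.ball v₀ R) := by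
    refine differentiableOn_continuousMap Metric.isOpen_ball hHc fun θ => ?_
    refine DifferentiableOn.congr (f := fun v => (circleMap v₀ R θ - v)⁻¹) (fun v hv => ?_)
      fun v hv => hH v hv θ
    refine (DifferentiableAt.inv (by fun_prop) fun h0 => ?_).differentiableWithinAt
    simp only [sub_eq_zero] at h0
    have h1 := circleMap_mem_sphere v₀ hR.le θ
    rw [h0] at h1
    exact (Metric.sphere_disjoint_ball).le_bot ⟨h1, hv⟩
  have hGa : AnalyticAt ℂ (fun p : ℂ × ℂ => G p.1) (z₀, v₀) :=
    (hGd.analyticAt (Metric.ball_mem_nhds z₀ hR)).fun_comp (f := Prod.fst) analyticAt_fst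
  have hHa : AnalyticAt ℂ (fun p : ℂ × ℂ => H p.2) (z₀, v₀) :=
    (hHd.analyticAt (Metric.ball_mem_nhds v₀ hR)).fun_comp (f := Prod.snd) analyticAt_snd
  have hprod : AnalyticAt ℂ (fun p : ℂ × ℂ => (2 * Real.pi * Complex.I : ℂ)⁻¹ *
      Λ (H p.2 * G p.1)) (z₀, v₀) :=
    analyticAt_const.mul ((Λ.analyticAt _).fun_comp (hHa.mul hGa))
  refine hprod.congr ?_
  have hnb : Metric.ball z₀ R ×ˢ Metric.ball v₀ R ∈ 𝓝 (z₀, v₀) :=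
    prod_mem_nhds (Metric.ball_mem_nhds z₀ hR) (Metric.ball_mem_nhds v₀ hR)
  filter_upwards [hnb] with p hp
  have hdz : DifferentiableOn ℂ (fun v => f (p.1, v)) (Metric.closedBall v₀ R) := fun v hv =>
    (h2 (p.1, v) (hmem _ (Metric.ball_subset_closedBall hp.1) _ hv)).differentiableWithinAt
  have hC := (hdz.diffContOnCl_ball
      subset_rfl).two_pi_i_inv_smul_circleIntegral_sub_inv_smul hp.2
  rw [← Prod.mk.eta (p := p)]
  simp only
  rw [← hC, smul_eq_mul]
  congr 1
  rw [circleIntegral, intervalIntegral.integral_of_le (by positivity),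
    ← integral_Icc_eq_integral_Ioc]
  refine hΛ _ _ fun θ => ?_
  rw [ContinuousMap.mul_apply, hG _ hp.1, hH _ hp.2]
  simp only [smul_eq_mul]
  ring

/-- Integrals over a compact set that depend holomorphically on two parameters are analytic. -/
theorem analyticOnNhd_setIntegral {X : Type*} [TopologicalSpace X] [T2Space X] [MeasurableSpace X]
    [BorelSpace X] {K : Set X} (hK : IsCompact K) (μ : Measure X) [IsFiniteMeasureOnCompacts μ]
    {W : Set (ℂ × ℂ)} (hW : IsOpen W) {f : ℂ × ℂ → X → ℂ}
    (hf : ContinuousOn (Function.uncurry f) (W ×ˢ K))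
    (hd : ∀ x ∈ K, ∀ p ∈ W, DifferentiableAt ℂ (fun q => f q x) p) :
    AnalyticOnNhd ℂ (fun p => ∫ x in K, f p x ∂μ) W := by
  have : CompactSpace K := isCompact_iff_compactSpace.1 hK
  obtain ⟨Λ, hΛ⟩ := exists_setIntegral_clm hK μ
  obtain ⟨G, hGc, hG⟩ := exists_continuousOn_continuousMap (P := ℂ × ℂ) (X := K) (W := W)
    (f := fun p x => f p x)
    (hf.comp (f := fun q : (ℂ × ℂ) × K => (q.1, (q.2 : X))) (by fun_prop)
      fun q hq => ⟨hq.1, q.2.2⟩)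
  have hΛG : ∀ p ∈ W, Λ (G p) = ∫ x in K, f p x ∂μ := fun p hp => hΛ _ _ fun x => hG p hp x
  refine AnalyticOnNhd.congr hW (f := fun p => Λ (G p)) ?_ hΛG
  refine analyticOnNhd_of_separately hW (Λ.continuous.comp_continuousOn hGc) ?_ ?_
  · rintro ⟨z₀, v₀⟩ hp
    have ho : IsOpen {z | (z, v₀) ∈ W} := hW.preimage (by fun_prop)
    have : DifferentiableOn ℂ (fun z => G (z, v₀)) {z | (z, v₀) ∈ W} := by
      refine differentiableOn_continuousMap ho (hGc.comp (by fun_prop) fun z hz => hz)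
        fun x => ?_
      refine DifferentiableOn.congr (f := fun z => f (z, v₀) x) (fun z hz => ?_)
        fun z hz => hG _ hz x
      exact ((hd x x.2 (z, v₀) hz).comp (f := fun z => (z, v₀)) z
        (by fun_prop)).differentiableWithinAt
    exact Λ.differentiableAt.comp z₀ (this.differentiableAt (ho.mem_nhds hp))
  · rintro ⟨z₀, v₀⟩ hp
    have ho : IsOpen {v | (z₀, v) ∈ W} := hW.preimage (by fun_prop)
    have : DifferentiableOn ℂ (fun v => G (z₀, v)) {v | (z₀, v) ∈ W} := by
      refine differentiableOn_continuousMap ho (hGc.comp (by fun_prop) fun z hz => hz)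
        fun x => ?_
      refine DifferentiableOn.congr (f := fun v => f (z₀, v) x) (fun v hv => ?_)
        fun v hv => hG _ hv x
      exact ((hd x x.2 (z₀, v) hv).comp (f := fun v => (z₀, v)) v
        (by fun_prop)).differentiableWithinAt
    exact Λ.differentiableAt.comp v₀ (this.differentiableAt (ho.mem_nhds hp))

theorem analyticOnNhd_intervalIntegral (s t : ℝ) {W : Set (ℂ × ℂ)} (hW : IsOpen W)
    {f : ℂ × ℂ → ℝ → ℂ} (hf : ContinuousOn (Function.uncurry f) (W ×ˢ Set.uIcc s t))
    (hd : ∀ x ∈ Set.uIcc s t, ∀ p ∈ W, DifferentiableAt ℂ (fun q => f q x) p) :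
    AnalyticOnNhd ℂ (fun p => ∫ x in s..t, f p x) W := by
  have key := analyticOnNhd_setIntegral isCompact_uIcc volume hW hf hd
  rcases le_total s t with hst | hst
  · refine key.congr hW fun p _ => ?_
    rw [intervalIntegral.integral_of_le hst, Set.uIcc_of_le hst, integral_Icc_eq_integral_Ioc]
  · refine key.neg.congr hW fun p _ => ?_
    rw [intervalIntegral.integral_of_ge hst, Set.uIcc_of_ge hst, ← integral_Icc_eq_integral_Ioc]
    rfl

/-! ### Integrals over three sides of a rectangle -/

/-- The set of points on the three sides of the rectangle with corners `±r`, `±r + ih` that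
do not lie on the real axis. -/
def capSet (r h : ℝ) : Set ℂ :=
  {ω | ω.im ∈ Set.uIcc 0 h ∧ ω.re ∈ Set.Icc (-r) r ∧ (|ω.re| = r ∨ ω.im = h)}

/-- The integral along the path `-r → -r + ih → r + ih → r`. -/
def capInt (r h : ℝ) (f : ℂ → ℂ) : ℂ :=
  Complex.I * (∫ y : ℝ in 0..h, f ((-r : ℝ) + y * Complex.I)) +
    (∫ x : ℝ in -r..r, f (x + h * Complex.I)) -
    Complex.I * ∫ y : ℝ in 0..h, f (r + y * Complex.I)

theorem left_mem_capSet {r h y : ℝ} (hr : 0 ≤ r) (hy : y ∈ Set.uIcc 0 h) :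
    ((-r : ℝ) + y * Complex.I : ℂ) ∈ capSet r h := by
  refine ⟨by simpa using hy, ?_, Or.inl ?_⟩ <;> simp [abs_of_nonneg hr]; linarith

theorem right_mem_capSet {r h y : ℝ} (hr : 0 ≤ r) (hy : y ∈ Set.uIcc 0 h) :
    (r + y * Complex.I : ℂ) ∈ capSet r h := by
  refine ⟨by simpa using hy, ?_, Or.inl ?_⟩ <;> simp [abs_of_nonneg hr]; linarith

theorem mid_mem_capSet {r h x : ℝ} (hr : 0 ≤ r) (hx : x ∈ Set.uIcc (-r) r) :
    (x + h * Complex.I : ℂ) ∈ capSet r h := by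
  rw [Set.uIcc_of_le (by linarith)] at hx
  exact ⟨by simp, by simpa using hx, Or.inr (by simp)⟩

theorem capInt_congr {r h : ℝ} (hr : 0 ≤ r) {f g : ℂ → ℂ} (hfg : Set.EqOn f g (capSet r h)) :
    capInt r h f = capInt r h g := by
  simp only [capInt]
  rw [intervalIntegral.integral_congr fun y hy => hfg (left_mem_capSet hr hy),
    intervalIntegral.integral_congr fun y hy => hfg (right_mem_capSet hr hy),
    intervalIntegral.integral_congr fun x hx => hfg (mid_mem_capSet hr hx)]

theorem capInt_sub_const_mul {r h : ℝ} (hr : 0 ≤ r) {f g : ℂ → ℂ} (C : ℂ)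
    (hf : ContinuousOn f (capSet r h)) (hg : ContinuousOn g (capSet r h)) :
    capInt r h (fun ω => f ω - C * g ω) = capInt r h f - C * capInt r h g := by
  have hl : ∀ {k : ℂ → ℂ}, ContinuousOn k (capSet r h) → IntervalIntegrable
      (fun y : ℝ => k ((-r : ℝ) + y * Complex.I)) volume 0 h := fun hk =>
    (hk.comp (by fun_prop) fun y hy => left_mem_capSet hr hy).intervalIntegrable
  have hR : ∀ {k : ℂ → ℂ}, ContinuousOn k (capSet r h) → IntervalIntegrable
      (fun y : ℝ => k (r + y * Complex.I)) volume 0 h := fun hk =>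
    (hk.comp (by fun_prop) fun y hy => right_mem_capSet hr hy).intervalIntegrable
  have hm : ∀ {k : ℂ → ℂ}, ContinuousOn k (capSet r h) → IntervalIntegrable
      (fun x : ℝ => k (x + h * Complex.I)) volume (-r) r := fun hk =>
    (hk.comp (by fun_prop) fun y hy => mid_mem_capSet hr hy).intervalIntegrable
  simp only [capInt]
  rw [intervalIntegral.integral_sub (hl hf) ((hl hg).const_mul C),
    intervalIntegral.integral_sub (hR hf) ((hR hg).const_mul C),
    intervalIntegral.integral_sub (hm hf) ((hm hg).const_mul C),
    intervalIntegral.integral_const_mul, intervalIntegral.integral_const_mul,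
    intervalIntegral.integral_const_mul]
  ring

theorem capInt_of_hasDerivAt {r h : ℝ} (hr : 0 ≤ r) {G g : ℂ → ℂ}
    (hG : ∀ ω ∈ capSet r h, HasDerivAt G (g ω) ω) (hg : ContinuousOn g (capSet r h)) :
    capInt r h g = G r - G (-r : ℝ) := by
  have hv : ∀ (A : ℂ) (y : ℝ), HasDerivAt (fun y : ℝ => A + y * Complex.I) Complex.I y := by
    intro A y
    simpa using ((Complex.ofRealCLM.hasDerivAt (x := y)).mul_const Complex.I).const_add A
  have e1 := intervalIntegral.integral_eq_sub_of_hasDerivAt (a := 0) (b := h)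
    (f := fun y : ℝ => G ((-r : ℝ) + y * Complex.I))
    (f' := fun y : ℝ => g ((-r : ℝ) + y * Complex.I) * Complex.I)
    (fun y hy => (hG _ (left_mem_capSet hr hy)).comp y (hv _ y))
    (((hg.comp (by fun_prop) fun y hy => left_mem_capSet hr hy).mul
      continuousOn_const).intervalIntegrable)
  have e2 := intervalIntegral.integral_eq_sub_of_hasDerivAt (a := 0) (b := h)
    (f := fun y : ℝ => G (r + y * Complex.I))
    (f' := fun y : ℝ => g (r + y * Complex.I) * Complex.I)
    (fun y hy => (hG _ (right_mem_capSet hr hy)).comp y (hv _ y))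
    (((hg.comp (by fun_prop) fun y hy => right_mem_capSet hr hy).mul
      continuousOn_const).intervalIntegrable)
  have e3 := intervalIntegral.integral_eq_sub_of_hasDerivAt (a := -r) (b := r)
    (f := fun x : ℝ => G (x + h * Complex.I))
    (f' := fun x : ℝ => g (x + h * Complex.I) * 1)
    (fun y hy => (hG _ (mid_mem_capSet hr hy)).comp y
      ((Complex.ofRealCLM.hasDerivAt (x := y)).add_const _))
    (((hg.comp (by fun_prop) fun y hy => mid_mem_capSet hr hy).mul
      continuousOn_const).intervalIntegrable)
  rw [intervalIntegral.integral_mul_const] at e1 e2 e3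
  rw [capInt, mul_comm Complex.I, mul_comm Complex.I, e1, e2]
  rw [mul_one] at e3
  rw [e3]
  simp

theorem analyticOnNhd_capInt {r h : ℝ} (hr : 0 ≤ r) {W : Set (ℂ × ℂ)} (hW : IsOpen W)
    {f : ℂ × ℂ → ℂ → ℂ} (hf : ContinuousOn (Function.uncurry f) (W ×ˢ capSet r h))
    (hd : ∀ x ∈ capSet r h, ∀ p ∈ W, DifferentiableAt ℂ (fun q => f q x) p) :
    AnalyticOnNhd ℂ (fun p => capInt r h (f p)) W := by
  have hl := analyticOnNhd_intervalIntegral 0 h hW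
    (f := fun p (y : ℝ) => f p ((-r : ℝ) + y * Complex.I))
    (hf.comp (f := fun q : (ℂ × ℂ) × ℝ => (q.1, ((-r : ℝ) + q.2 * Complex.I : ℂ)))
      (by fun_prop) fun q hq => ⟨hq.1, left_mem_capSet hr hq.2⟩)
    fun y hy => hd _ (left_mem_capSet hr hy)
  have hR := analyticOnNhd_intervalIntegral 0 h hW
    (f := fun p (y : ℝ) => f p (r + y * Complex.I))
    (hf.comp (f := fun q : (ℂ × ℂ) × ℝ => (q.1, (r + q.2 * Complex.I : ℂ)))
      (by fun_prop) fun q hq => ⟨hq.1, right_mem_capSet hr hq.2⟩)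
    fun y hy => hd _ (right_mem_capSet hr hy)
  have hm := analyticOnNhd_intervalIntegral (-r) r hW
    (f := fun p (x : ℝ) => f p (x + h * Complex.I))
    (hf.comp (f := fun q : (ℂ × ℂ) × ℝ => (q.1, (q.2 + h * Complex.I : ℂ)))
      (by fun_prop) fun q hq => ⟨hq.1, mid_mem_capSet hr hq.2⟩)
    fun y hy => hd _ (mid_mem_capSet hr hy)
  exact ((analyticOnNhd_const.mul hl).add hm).sub (analyticOnNhd_const.mul hR)

theorem norm_lt_of_abs_le {r : ℝ} (hr : 0 < r) {ω : ℂ} (h1 : |ω.re| ≤ r) (h2 : |ω.im| ≤ r) :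
    ‖ω‖ < 2 * r := by
  have : ‖ω‖ ^ 2 < (2 * r) ^ 2 := by
    rw [← Complex.normSq_eq_norm_sq, Complex.normSq_apply]
    nlinarith [abs_mul_abs_self ω.re, abs_mul_abs_self ω.im, abs_nonneg ω.re, abs_nonneg ω.im]
  exact lt_of_pow_lt_pow_left₀ 2 (by positivity) this

/-- The lower bound keeps the sides away from the disc of radius `r / 3` where the parameters live;
the upper bound keeps them inside the domain of the chart. -/
theorem norm_mem_of_mem_capSet {r h : ℝ} (hr : 0 < r) (hh : |h| = r) {ω : ℂ}
    (hω : ω ∈ capSet r h) : r ≤ ‖ω‖ ∧ ‖ω‖ < 2 * r := by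
  obtain ⟨h1, h2, h3⟩ := hω
  have him : |ω.im| ≤ r := by
    rw [← hh]
    simpa using Set.abs_sub_left_of_mem_uIcc h1
  have hre : |ω.re| ≤ r := abs_le.2 h2
  constructor
  · rcases h3 with h3 | h3
    · exact h3 ▸ Complex.abs_re_le_norm ω
    · rw [← hh, ← h3]
      exact Complex.abs_im_le_norm ω
  · exact norm_lt_of_abs_le hr hre him

/-! ### Nearly linear maps: branches of the logarithm and a residue -/

/-- `Φ` is holomorphic on the disc of radius `2 r` and close to a linear map with slope `c`. -/
structure NearlyLinear (Φ : ℂ → ℂ) (c : ℂ) (r : ℝ) : Prop where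
  ne_zero : c ≠ 0
  pos : 0 < r
  diff : DifferentiableOn ℂ Φ (Metric.ball 0 (2 * r))
  approx : ∀ x ∈ Metric.ball (0 : ℂ) (2 * r), ∀ y ∈ Metric.ball (0 : ℂ) (2 * r),
    ‖Φ x - Φ y - c * (x - y)‖ ≤ ‖c‖ / 2 * ‖x - y‖

/-- To reach the closed negative axis from the closed right half-plane, `e` must cancel the
imaginary part of `a` and at least its real part, hence be at least as long as `a`. -/
theorem mem_slitPlane_add {a e : ℂ} (ha : 0 ≤ a.re) (he : ‖e‖ < ‖a‖) :
    a + e ∈ Complex.slitPlane := by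
  rw [Complex.mem_slitPlane_iff]
  by_contra! h
  obtain ⟨h1, h2⟩ := h
  have h3 : ‖e‖ ^ 2 < ‖a‖ ^ 2 := by gcongr
  rw [← Complex.normSq_eq_norm_sq, ← Complex.normSq_eq_norm_sq, Complex.normSq_apply,
    Complex.normSq_apply] at h3
  simp only [Complex.add_re, Complex.add_im] at h1 h2
  have h4 : e.im = -a.im := by linarith
  rw [h4] at h3
  nlinarith

namespace NearlyLinear

variable {Φ : ℂ → ℂ} {c : ℂ} {r : ℝ}

theorem norm_div_sub_le (H : NearlyLinear Φ c r) {x y : ℂ} (hx : ‖x‖ < 2 * r)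
    (hy : ‖y‖ < 2 * r) : ‖(Φ x - Φ y) / c - (x - y)‖ ≤ ‖x - y‖ / 2 := by
  have hc : 0 < ‖c‖ := norm_pos_iff.2 H.ne_zero
  have : (Φ x - Φ y) / c - (x - y) = (Φ x - Φ y - c * (x - y)) / c := by
    field_simp [H.ne_zero]
  rw [this, norm_div, div_le_iff₀ hc]
  have := H.approx x (by simpa using hx) y (by simpa using hy)
  linarith

theorem ne (H : NearlyLinear Φ c r) {x y : ℂ} (hx : ‖x‖ < 2 * r) (hy : ‖y‖ < 2 * r)
    (hxy : x ≠ y) : Φ x - Φ y ≠ 0 := by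
  intro h
  have := H.norm_div_sub_le hx hy
  rw [h, zero_div, zero_sub, norm_neg] at this
  have h2 : 0 < ‖x - y‖ := norm_pos_iff.2 (sub_ne_zero.2 hxy)
  linarith

theorem differentiableAt (H : NearlyLinear Φ c r) {x : ℂ} (hx : ‖x‖ < 2 * r) :
    DifferentiableAt ℂ Φ x :=
  H.diff.differentiableAt (Metric.isOpen_ball.mem_nhds (by simpa using hx))

theorem norm_deriv_sub_le (H : NearlyLinear Φ c r) {x : ℂ} (hx : ‖x‖ < 2 * r) :
    ‖deriv Φ x - c‖ ≤ ‖c‖ / 2 := by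
  have h1 : HasDerivAt (fun y => Φ y - c * y) (deriv Φ x - c) x := by
    exact ((H.differentiableAt hx).hasDerivAt.fun_sub
      ((hasDerivAt_id' x).const_mul c)).congr_deriv (by ring)
  refine h1.le_of_lip' (by positivity) ?_
  filter_upwards [Metric.isOpen_ball.mem_nhds (show x ∈ Metric.ball 0 (2 * r) by simpa using hx)]
    with y hy
  have e : Φ y - c * y - (Φ x - c * x) = Φ y - Φ x - c * (y - x) := by ring
  rw [e]
  exact H.approx y hy x (by simpa using hx)

theorem deriv_ne_zero (H : NearlyLinear Φ c r) {x : ℂ} (hx : ‖x‖ < 2 * r) : deriv Φ x ≠ 0 := by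
  intro h
  have := H.norm_deriv_sub_le hx
  rw [h, zero_sub, norm_neg] at this
  have hc : 0 < ‖c‖ := norm_pos_iff.2 H.ne_zero
  linarith

theorem continuousOn_deriv (H : NearlyLinear Φ c r) :
    ContinuousOn (deriv Φ) (Metric.ball 0 (2 * r)) :=
  (H.diff.deriv Metric.isOpen_ball).continuousOn

theorem mem_slitPlane_of_im_lt (H : NearlyLinear Φ c r) {x y : ℂ} (hx : ‖x‖ < 2 * r)
    (hy : ‖y‖ < 2 * r) (hxy : y.im < x.im) :
    -Complex.I * ((Φ x - Φ y) / c) ∈ Complex.slitPlane := by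
  have h1 := H.norm_div_sub_le hx hy
  have h2 : 0 < ‖x - y‖ := norm_pos_iff.2 (sub_ne_zero.2 fun h => by simp [h] at hxy)
  have : -Complex.I * ((Φ x - Φ y) / c) =
    -Complex.I * (x - y) + -Complex.I * ((Φ x - Φ y) / c - (x - y)) := by ring
  rw [this]
  refine mem_slitPlane_add (by simpa using hxy.le) ?_
  simp only [norm_mul, norm_neg, Complex.norm_I, one_mul]
  linarith

/-- Here `y` may lie on either side of the real axis. Compared with `x`, the error is at most `‖x -
y‖ / 2 + ‖y‖ ≤ ‖x‖ / 2 + 3 * ‖y‖ / 2`, which is below `‖x‖` exactly when `‖y‖ < ‖x‖ / 3`; hence the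
radius `r / 3` used throughout. -/
theorem mem_slitPlane_of_norm_lt (H : NearlyLinear Φ c r) {x y : ℂ} (hx : ‖x‖ < 2 * r)
    (hxy : ‖y‖ < ‖x‖ / 3) (him : 0 ≤ x.im) :
    -Complex.I * ((Φ x - Φ y) / c) ∈ Complex.slitPlane := by
  have hy : ‖y‖ < 2 * r := by linarith [norm_nonneg x]
  have h1 := H.norm_div_sub_le hx hy
  have h2 : ‖x - y‖ ≤ ‖x‖ + ‖y‖ := norm_sub_le x y
  have : -Complex.I * ((Φ x - Φ y) / c) =
    -Complex.I * x + -Complex.I * ((Φ x - Φ y) / c - (x - y) - y) := by ring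
  rw [this]
  refine mem_slitPlane_add (by simpa using him) ?_
  simp only [norm_mul, norm_neg, Complex.norm_I, one_mul]
  have h3 := norm_sub_le ((Φ x - Φ y) / c - (x - y)) y
  linarith

theorem mem_slitPlane_of_norm_lt' (H : NearlyLinear Φ c r) {x y : ℂ} (hx : ‖x‖ < 2 * r)
    (hxy : ‖y‖ < ‖x‖ / 3) (him : x.im ≤ 0) :
    Complex.I * ((Φ x - Φ y) / c) ∈ Complex.slitPlane := by
  have hy : ‖y‖ < 2 * r := by linarith [norm_nonneg x]
  have h1 := H.norm_div_sub_le hx hy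
  have h2 : ‖x - y‖ ≤ ‖x‖ + ‖y‖ := norm_sub_le x y
  have : Complex.I * ((Φ x - Φ y) / c) =
    Complex.I * x + Complex.I * ((Φ x - Φ y) / c - (x - y) - y) := by ring
  rw [this]
  refine mem_slitPlane_add (by simpa using him) ?_
  simp only [norm_mul, Complex.norm_I, one_mul]
  have h3 := norm_sub_le ((Φ x - Φ y) / c - (x - y)) y
  linarith

theorem hasDerivAt_log (H : NearlyLinear Φ c r) {x v k : ℂ} (hx : ‖x‖ < 2 * r)
    (hk : k ≠ 0) (hs : k * ((Φ x - v) / c) ∈ Complex.slitPlane) :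
    HasDerivAt (fun u => Complex.log (k * ((Φ u - v) / c))) (deriv Φ x / (Φ x - v)) x := by
  have h1 := ((((H.differentiableAt hx).hasDerivAt.sub_const v).div_const c).const_mul k).clog hs
  convert h1 using 1
  have : Φ x - v ≠ 0 := by
    rintro h
    rw [h] at hs
    simp at hs
  field_simp [H.ne_zero]

theorem continuousOn_logDeriv (H : NearlyLinear Φ c r) {α : ℂ} {s : Set ℂ}
    (hs : s ⊆ Metric.ball 0 (2 * r)) (hα : ‖α‖ < 2 * r) (hαs : α ∉ s) :
    ContinuousOn (fun ω => deriv Φ ω / (Φ ω - Φ α)) s :=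
  (H.continuousOn_deriv.mono hs).div ((H.diff.continuousOn.mono hs).sub continuousOn_const)
    fun ω hω => H.ne (by simpa using hs hω) hα fun h => hαs (h ▸ hω)

/-- The residue theorem on the square, by explicit primitives: one branch of the logarithm serves
the upper sides, another the lower sides. The branches differ by `π I` at `r` and by `-π I` at `-r`.
-/
theorem capInt_sub_capInt (H : NearlyLinear Φ c r) {α : ℂ} (hα : ‖α‖ < r / 3) :
    capInt r (-r) (fun ω => deriv Φ ω / (Φ ω - Φ α)) -
      capInt r r (fun ω => deriv Φ ω / (Φ ω - Φ α)) = 2 * Real.pi * Complex.I := by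
  have hr := H.pos
  have hα2 : ‖α‖ < 2 * r := by linarith
  have hu : ∀ ω ∈ capSet r r, r ≤ ‖ω‖ ∧ ‖ω‖ < 2 * r := fun ω hω =>
    norm_mem_of_mem_capSet hr (abs_of_pos hr) hω
  have hl : ∀ ω ∈ capSet r (-r), r ≤ ‖ω‖ ∧ ‖ω‖ < 2 * r := fun ω hω =>
    norm_mem_of_mem_capSet hr (by rw [abs_neg, abs_of_pos hr]) hω
  have hU := capInt_of_hasDerivAt (h := r) hr.le
    (G := fun u => Complex.log (-Complex.I * ((Φ u - Φ α) / c)))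
    (g := fun ω => deriv Φ ω / (Φ ω - Φ α))
    (fun ω hω => H.hasDerivAt_log (hu ω hω).2 (neg_ne_zero.2 Complex.I_ne_zero)
      (H.mem_slitPlane_of_norm_lt (hu ω hω).2 (by linarith [(hu ω hω).1]) (by
        have := hω.1
        rw [Set.uIcc_of_le hr.le] at this
        exact this.1)))
    (H.continuousOn_logDeriv (fun ω hω => by simpa using (hu ω hω).2) hα2
      fun h => by linarith [(hu α h).1])
  have hL := capInt_of_hasDerivAt (h := -r) hr.le
    (G := fun u => Complex.log (Complex.I * ((Φ u - Φ α) / c)))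
    (g := fun ω => deriv Φ ω / (Φ ω - Φ α))
    (fun ω hω => H.hasDerivAt_log (hl ω hω).2 Complex.I_ne_zero
      (H.mem_slitPlane_of_norm_lt' (hl ω hω).2 (by linarith [(hl ω hω).1]) (by
        have := hω.1
        rw [Set.uIcc_of_ge (by linarith)] at this
        exact this.2)))
    (H.continuousOn_logDeriv (fun ω hω => by simpa using (hl ω hω).2) hα2
      fun h => by linarith [(hl α h).1])
  -- The error is at most `(r + ‖α‖) / 2 < 2 * r / 3`, while `|x - α.re| > 2 * r / 3`. This fixes
  -- the sign of the real part at `r` and at `-r`.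
  have key : ∀ x : ℝ, |x| = r →
      |((Φ x - Φ α) / c).re - (x - α.re)| < |x - α.re| := by
    intro x hx
    have hx2 : ‖(x : ℂ)‖ = r := by simpa using hx
    have h1 := H.norm_div_sub_le (x := x) (y := α) (by linarith) hα2
    have h2 := (Complex.abs_re_le_norm _).trans h1
    have h3 : ‖(x : ℂ) - α‖ ≤ r + ‖α‖ := hx2 ▸ norm_sub_le _ _
    have h4 : |x| - |α.re| ≤ |x - α.re| := abs_sub_abs_le_abs_sub _ _
    have h5 := Complex.abs_re_le_norm α
    simp only [Complex.sub_re, Complex.ofReal_re] at h2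
    linarith
  have hαre := Complex.abs_re_le_norm α
  have hαre' := abs_le.1 hαre
  have hp : 0 < ((Φ r - Φ α) / c).re := by
    have := abs_lt.1 (key r (abs_of_pos hr))
    rw [abs_of_pos (by linarith)] at this
    linarith
  have hn : ((Φ (-r : ℝ) - Φ α) / c).re < 0 := by
    have := abs_lt.1 (key (-r) (by rw [abs_neg, abs_of_pos hr]))
    rw [abs_of_neg (by linarith)] at this
    linarith
  have hlogp : ∀ X : ℂ, 0 < X.re → Complex.log (Complex.I * X) - Complex.log (-Complex.I * X) =
      Real.pi * Complex.I := by
    intro X hX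
    have h1 : Complex.I * X = -(-Complex.I * X) := by ring
    rw [h1, Complex.log, Complex.log, Complex.arg_neg_eq_arg_add_pi_of_im_neg (by simpa using hX)]
    simp
    ring
  have hlogn : ∀ X : ℂ, X.re < 0 → Complex.log (Complex.I * X) - Complex.log (-Complex.I * X) =
      -(Real.pi * Complex.I) := by
    intro X hX
    have h1 : Complex.I * X = -(-Complex.I * X) := by ring
    rw [h1, Complex.log, Complex.log, Complex.arg_neg_eq_arg_sub_pi_of_im_pos (by simpa using hX)]
    simp
    ring
  rw [hU, hL]
  linear_combination hlogp _ hp - hlogn _ hn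

end NearlyLinear

/-! ### Stokes below the real axis, Cauchy above it -/

/-- Stokes' theorem on the lower half of a square, for the product of a holomorphic and an
antiholomorphic function. -/
theorem capInt_sub_integral_eq {r : ℝ} (hr : 0 < r) {N : Set ℂ} (hN : IsOpen N)
    {N' : Set ℂ} (hN' : IsOpen N') {p M : ℂ → ℂ}
    (hp : DifferentiableOn ℂ p N) (hM : DifferentiableOn ℂ M N')
    (hsub : ∀ ω : ℂ, |ω.re| ≤ r → ω.im ∈ Set.Icc (-r) 0 → ω ∈ N ∧ conj ω ∈ N') :
    capInt r (-r) (fun ω => p ω * M (conj ω)) - (∫ x : ℝ in -r..r, p x * M x) =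
      ∫ x : ℝ in -r..r, ∫ y : ℝ in -r..0,
        2 * Complex.I * (p (x + y * Complex.I) * deriv M (conj (x + y * Complex.I))) := by
  set z : ℂ := ⟨-r, -r⟩ with hz
  set w : ℂ := ⟨r, 0⟩ with hw
  let f : ℂ → ℂ := fun ω => p ω * M (conj ω)
  let f' : ℂ → ℂ →L[ℝ] ℂ := fun ω =>
    p ω • (deriv M (conj ω) • (Complex.conjCLE : ℂ →L[ℝ] ℂ)) +
      M (conj ω) • (deriv p ω • ContinuousLinearMap.id ℝ ℂ)
  have hmem : ∀ ω ∈ Set.uIcc z.re w.re ×ℂ Set.uIcc z.im w.im, ω ∈ N ∧ conj ω ∈ N' := by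
    intro ω hω
    rw [Complex.mem_reProdIm, Set.uIcc_of_le (by simp [hz, hw]; linarith),
      Set.uIcc_of_le (by simp [hz, hw]; linarith)] at hω
    exact hsub ω (abs_le.2 hω.1) hω.2
  have hfd : ∀ ω, ω ∈ N → conj ω ∈ N' → HasFDerivAt f (f' ω) ω := by
    intro ω h1 h2
    have hp1 : HasFDerivAt p (deriv p ω • ContinuousLinearMap.id ℝ ℂ) ω := by
      have := (hp.differentiableAt (hN.mem_nhds h1)).hasDerivAt.hasFDerivAt.restrictScalars ℝ
      refine this.congr_fderiv ?_
      ext; simp [mul_comm]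
    have hM1 : HasFDerivAt (fun ω => M (conj ω))
        (deriv M (conj ω) • (Complex.conjCLE : ℂ →L[ℝ] ℂ)) ω := by
      have := (hM.differentiableAt (hN'.mem_nhds h2)).hasDerivAt.hasFDerivAt.restrictScalars ℝ
      refine (this.comp ω (Complex.conjCLE : ℂ →L[ℝ] ℂ).hasFDerivAt).congr_fderiv ?_
      ext; simp [mul_comm]
    exact hp1.mul hM1
  -- The left side is `2 I` times the `∂/∂(conj ω)` derivative, which sees only the antiholomorphic
  -- factor.
  have hexp : ∀ ω, Complex.I • f' ω 1 - f' ω Complex.I =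
      2 * Complex.I * (p ω * deriv M (conj ω)) := by
    intro ω
    simp [f']
    ring
  have key := Complex.integral_boundary_rect_of_hasFDerivAt_real_off_countable f f' z w ∅
    Set.countable_empty
    (fun ω hω => (hfd ω (hmem ω hω).1 (hmem ω hω).2).continuousAt.continuousWithinAt)
    (fun ω hω => by
      have hω2 : ω ∈ Set.uIcc z.re w.re ×ℂ Set.uIcc z.im w.im :=
        ⟨Set.Ioo_subset_Icc_self hω.1.1, Set.Ioo_subset_Icc_self hω.1.2⟩
      exact hfd ω (hmem ω hω2).1 (hmem ω hω2).2)
    (by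
      simp only [hexp]
      refine ContinuousOn.integrableOn_compact (isCompact_uIcc.reProdIm isCompact_uIcc) ?_
      refine continuousOn_const.mul (ContinuousOn.mul ?_ ?_)
      · exact hp.continuousOn.mono fun ω hω => (hmem ω hω).1
      · exact (hM.deriv hN').continuousOn.comp Complex.continuous_conj.continuousOn
          fun ω hω => (hmem ω hω).2)
  simp only [hexp] at key
  simp only [hz, hw] at key
  rw [← key]
  simp only [capInt, f, smul_eq_mul]
  rw [intervalIntegral.integral_symm (-r) 0, intervalIntegral.integral_symm (-r) 0]
  simp
  ring

theorem capInt_eq_integral {r : ℝ} (hr : 0 < r) {F : ℂ → ℂ} {N : Set ℂ}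
    (hF : DifferentiableOn ℂ F N)
    (hsub : ∀ ω : ℂ, |ω.re| ≤ r → ω.im ∈ Set.Icc 0 r → ω ∈ N) :
    capInt r r F = ∫ x : ℝ in -r..r, F x := by
  have key := Complex.integral_boundary_rect_eq_zero_of_differentiableOn F ⟨-r, 0⟩ ⟨r, r⟩
    (hF.mono fun ω hω => by
      rw [Complex.mem_reProdIm, Set.uIcc_of_le (by simp; linarith),
        Set.uIcc_of_le (by simpa using hr.le)] at hω
      exact hsub ω (abs_le.2 hω.1) hω.2)
  simp only [smul_eq_mul, Complex.ofReal_zero, zero_mul, add_zero] at key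
  rw [capInt]
  linear_combination -key

namespace NearlyLinear

/-- The double Cauchy integral over the lower half of a square, in the straightened
coordinates. -/
theorem integral_lower_half {Φ Ψ : ℂ → ℂ} {c d : ℂ} {r : ℝ} (H : NearlyLinear Φ c r)
    (K : NearlyLinear Ψ d r) {α b : ℂ} (hα : ‖α‖ < r / 3) (hb : ‖b‖ < r / 3) (hα0 : 0 < α.im)
    (hb0 : b.im < 0) :
    2 * Complex.I * (∫ x : ℝ in -r..r, ∫ y : ℝ in -r..0,
        deriv Φ (x + y * Complex.I) / (Φ (x + y * Complex.I) - Φ α) *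
          (deriv Ψ (conj (x + y * Complex.I)) / (Ψ (conj (x + y * Complex.I)) - Ψ b))) =
      capInt r (-r) (fun ω => deriv Φ ω / (Φ ω - Φ α) *
        Complex.log (-Complex.I * ((Ψ (conj ω) - Ψ b) / d))) -
      capInt r r (fun ω => deriv Φ ω / (Φ ω - Φ α) *
        Complex.log (-Complex.I * ((Ψ ω - Ψ b) / d))) -
      2 * Real.pi * Complex.I * Complex.log (-Complex.I * ((Ψ α - Ψ b) / d)) := by
  have hr := H.pos
  have hα2 : ‖α‖ < 2 * r := by linarith
  have hb2 : ‖b‖ < 2 * r := by linarith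
  set B := Metric.ball (0 : ℂ) (2 * r) with hB
  set p : ℂ → ℂ := fun ω => deriv Φ ω / (Φ ω - Φ α) with hp
  set Lg : ℂ → ℂ := fun u => Complex.log (-Complex.I * ((Ψ u - Ψ b) / d)) with hLg
  have hLgd : ∀ u, ‖u‖ < 2 * r → b.im < u.im → HasDerivAt Lg (deriv Ψ u / (Ψ u - Ψ b)) u :=
    fun u h1 h2 => K.hasDerivAt_log h1 (neg_ne_zero.2 Complex.I_ne_zero)
      (K.mem_slitPlane_of_im_lt h1 hb2 h2)
  -- Since `b` is below the real axis and `α` above it, the domain `N'` of the logarithm and the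
  -- domain `N` of `p` both extend across the axis.
  let N' : Set ℂ := B ∩ {u | b.im < u.im}
  have hN' : IsOpen N' := Metric.isOpen_ball.inter
    (isOpen_lt continuous_const Complex.continuous_im)
  have hN'm : ∀ {u}, u ∈ N' ↔ ‖u‖ < 2 * r ∧ b.im < u.im := by simp [N', hB]
  have hLgN : DifferentiableOn ℂ Lg N' := fun u hu =>
    (hLgd u (hN'm.1 hu).1 (hN'm.1 hu).2).differentiableAt.differentiableWithinAt
  have hαN : α ∈ N' := hN'm.2 ⟨hα2, by linarith⟩
  let N : Set ℂ := B ∩ {u | u.im < α.im}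
  have hN : IsOpen N := Metric.isOpen_ball.inter
    (isOpen_lt Complex.continuous_im continuous_const)
  have hNm : ∀ {u}, u ∈ N ↔ ‖u‖ < 2 * r ∧ u.im < α.im := by simp [N, hB]
  have hpN : DifferentiableOn ℂ p N := by
    refine ((H.diff.deriv Metric.isOpen_ball).mono Set.inter_subset_left).div
      ((H.diff.mono Set.inter_subset_left).sub_const _) fun ω hω => ?_
    exact H.ne (hNm.1 hω).1 hα2 fun h => lt_irrefl _ (h ▸ (hNm.1 hω).2)
  have hu : ∀ ω ∈ capSet r r, r ≤ ‖ω‖ ∧ ‖ω‖ < 2 * r ∧ 0 ≤ ω.im := fun ω hω =>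
    ⟨(norm_mem_of_mem_capSet hr (abs_of_pos hr) hω).1,
      (norm_mem_of_mem_capSet hr (abs_of_pos hr) hω).2, by
        have := hω.1
        rw [Set.uIcc_of_le hr.le] at this
        exact this.1⟩
  have hl : ∀ ω ∈ capSet r (-r), r ≤ ‖ω‖ ∧ ‖ω‖ < 2 * r ∧ ω.im ≤ 0 := fun ω hω =>
    ⟨(norm_mem_of_mem_capSet hr (by rw [abs_neg, abs_of_pos hr]) hω).1,
      (norm_mem_of_mem_capSet hr (by rw [abs_neg, abs_of_pos hr]) hω).2, by
        have := hω.1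
        rw [Set.uIcc_of_ge (by linarith)] at this
        exact this.2⟩
  have hpu : ContinuousOn p (capSet r r) :=
    H.continuousOn_logDeriv (fun ω hω => by simpa using (hu ω hω).2.1) hα2
      fun h => by linarith [(hu α h).1]
  have hpl : ContinuousOn p (capSet r (-r)) :=
    H.continuousOn_logDeriv (fun ω hω => by simpa using (hl ω hω).2.1) hα2
      fun h => by linarith [(hl α h).1]
  have hLu : ContinuousOn Lg (capSet r r) := hLgN.continuousOn.mono fun ω hω =>
    hN'm.2 ⟨(hu ω hω).2.1, by linarith [(hu ω hω).2.2]⟩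
  have hLl : ContinuousOn (fun ω => Lg (conj ω)) (capSet r (-r)) :=
    hLgN.continuousOn.comp Complex.continuous_conj.continuousOn fun ω hω =>
      hN'm.2 ⟨by simpa using (hl ω hω).2.1, by
        rw [Complex.conj_im]; linarith [(hl ω hω).2.2]⟩
  -- The primitive is normalized to vanish at `α`, where `p` has its pole.
  set M : ℂ → ℂ := fun u => Lg u - Lg α with hM
  have hMN : DifferentiableOn ℂ M N' := hLgN.sub_const _
  have stokes := capInt_sub_integral_eq hr hN hN' hpN hMN fun ω h1 h2 => by
    have h3 : ‖ω‖ < 2 * r := norm_lt_of_abs_le hr h1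
      (abs_le.2 ⟨h2.1, h2.2.trans hr.le⟩)
    exact ⟨hNm.2 ⟨h3, by linarith [h2.2]⟩, hN'm.2 ⟨by simpa using h3, by
      rw [Complex.conj_im]; linarith [h2.2]⟩⟩
  have hds : ∀ ω ∈ B, dslope Φ α ω ≠ 0 := by
    intro ω hω
    rcases eq_or_ne ω α with rfl | hne
    · rw [dslope_same]
      exact H.deriv_ne_zero hα2
    · rw [dslope_of_ne _ hne, slope_def_field]
      exact div_ne_zero (H.ne (by simpa [hB] using hω) hα2 hne) (sub_ne_zero.2 hne)
  -- This is `p * M` with the singularity at `α` removed: numerator and denominator are both divided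
  -- by `ω - α`.
  set F : ℂ → ℂ := fun ω => deriv Φ ω * dslope Lg α ω / dslope Φ α ω with hF
  have hFN : DifferentiableOn ℂ F N' := by
    refine DifferentiableOn.div (DifferentiableOn.mul
      ((H.diff.deriv Metric.isOpen_ball).mono Set.inter_subset_left)
      ((Complex.differentiableOn_dslope (hN'.mem_nhds hαN)).2 hLgN))
      ((Complex.differentiableOn_dslope (hN'.mem_nhds hαN)).2
        (H.diff.mono Set.inter_subset_left)) fun ω hω => hds ω hω.1
  have hFeq : ∀ ω, ω ≠ α → F ω = p ω * M ω := by
    intro ω hω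
    have := sub_ne_zero.2 hω
    simp only [hF, dslope_of_ne _ hω, slope_def_field, hp, hM]
    field_simp
  have cauchy := capInt_eq_integral hr hFN fun ω h1 h2 => by
    have h3 : ‖ω‖ < 2 * r := norm_lt_of_abs_le hr h1
      (abs_le.2 ⟨by linarith [h2.1], h2.2⟩)
    exact hN'm.2 ⟨h3, by linarith [h2.1]⟩
  have e1 : (∫ x : ℝ in -r..r, F x) = ∫ x : ℝ in -r..r, p x * M x :=
    intervalIntegral.integral_congr fun x _ => hFeq _ fun h => by simp [← h] at hα0
  have e2 : capInt r r F = capInt r r (fun ω => p ω * Lg ω - Lg α * p ω) :=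
    capInt_congr hr.le fun ω hω => by
      rw [hFeq ω fun h => by have := (hu ω hω).1; rw [h] at this; linarith]
      simp only [hM]
      ring
  have e3 : capInt r (-r) (fun ω => p ω * M (conj ω)) =
      capInt r (-r) (fun ω => p ω * Lg (conj ω) - Lg α * p ω) :=
    capInt_congr hr.le fun ω hω => by
      simp only [hM]
      ring
  rw [capInt_sub_const_mul (f := fun ω => p ω * Lg ω) hr.le _ (hpu.mul hLu) hpu] at e2
  rw [capInt_sub_const_mul (f := fun ω => p ω * Lg (conj ω)) hr.le _ (hpl.mul hLl) hpl] at e3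
  have e4 : (∫ x : ℝ in -r..r, ∫ y : ℝ in -r..0,
        2 * Complex.I * (p (x + y * Complex.I) * deriv M (conj (x + y * Complex.I)))) =
      2 * Complex.I * ∫ x : ℝ in -r..r, ∫ y : ℝ in -r..0, p (x + y * Complex.I) *
        (deriv Ψ (conj (x + y * Complex.I)) / (Ψ (conj (x + y * Complex.I)) - Ψ b)) := by
    rw [← intervalIntegral.integral_const_mul]
    refine intervalIntegral.integral_congr fun x hx => ?_
    rw [← intervalIntegral.integral_const_mul]
    refine intervalIntegral.integral_congr fun y hy => ?_
    rw [Set.uIcc_of_le (by linarith)] at hx hy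
    have hn : ‖(x + y * Complex.I : ℂ)‖ < 2 * r := norm_lt_of_abs_le hr
      (by simpa using abs_le.2 hx) (by simpa using abs_le.2 ⟨hy.1, hy.2.trans hr.le⟩)
    have := ((hLgd (conj (x + y * Complex.I)) (by rwa [Complex.norm_conj]) (by
      simp; linarith [hy.2])).sub_const (Lg α)).deriv
    simp only [hM, this]
  rw [e4] at stokes
  -- The subtracted constant `Lg α` comes back multiplied by the residue; this is the only singular
  -- term.
  have res := H.capInt_sub_capInt hα
  rw [← stokes, e3, ← e1, ← cauchy, e2]
  linear_combination -(Lg α) * res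

end NearlyLinear

/-! ### Reflected chart, difference quotients, inverse and change of variables -/

/-- The function `u ↦ conj (Φ (conj u))`. -/
def reflect (Φ : ℂ → ℂ) (u : ℂ) : ℂ := conj (Φ (conj u))

theorem det_restrictScalars_toSpanSingleton (z : ℂ) :
    ((ContinuousLinearMap.toSpanSingleton ℂ z).restrictScalars ℝ : ℂ →L[ℝ] ℂ).det =
      Complex.normSq z := by
  rw [← Algebra.norm_complex_apply, Algebra.norm_apply, ContinuousLinearMap.det]
  congr 1
  ext; simp [mul_comm]

theorem setIntegral_reProdIm {G : ℂ → ℂ} {r : ℝ} (hr : 0 < r)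
    (hG : IntegrableOn G (Set.Ioo (-r) r ×ℂ Set.Ioo (-r) 0)) :
    ∫ ω in Set.Ioo (-r) r ×ℂ Set.Ioo (-r) 0, G ω =
      ∫ x : ℝ in -r..r, ∫ y : ℝ in -r..0, G (x + y * Complex.I) := by
  have hmp := Complex.volume_preserving_equiv_real_prod.symm
  have hemb := Complex.measurableEquivRealProd.symm.measurableEmbedding
  have hpre : Complex.measurableEquivRealProd.symm ⁻¹' (Set.Ioo (-r) r ×ℂ Set.Ioo (-r) 0) =
      Set.Ioo (-r) r ×ˢ Set.Ioo (-r) 0 := by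
    ext; rfl
  rw [← hmp.setIntegral_preimage_emb hemb, hpre]
  have hint : IntegrableOn (fun p => G (Complex.measurableEquivRealProd.symm p))
      (Set.Ioo (-r) r ×ˢ Set.Ioo (-r) 0) := by
    rw [← hpre]
    exact (hmp.integrableOn_comp_preimage hemb).2 hG
  rw [Measure.volume_eq_prod] at hint ⊢
  rw [setIntegral_prod _ hint, intervalIntegral.integral_of_le (by linarith),
    integral_Ioc_eq_integral_Ioo]
  refine setIntegral_congr_fun measurableSet_Ioo fun x _ => ?_
  rw [intervalIntegral.integral_of_le (by linarith), integral_Ioc_eq_integral_Ioo]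
  refine setIntegral_congr_fun measurableSet_Ioo fun y _ => ?_
  simp only [Complex.measurableEquivRealProd_symm_apply]
  congr 1
  exact Complex.mk_eq_add_mul_I x y

theorem log_mul_of_re_pos {x y : ℂ} (hx : 0 < x.re) (hy : 0 < y.re) :
    Complex.log (x * y) = Complex.log x + Complex.log y := by
  have hx0 : x ≠ 0 := fun h => by simp [h] at hx
  have hy0 : y ≠ 0 := fun h => by simp [h] at hy
  have h1 := abs_lt.1 (Complex.abs_arg_lt_pi_div_two_iff.2 (Or.inl hx))
  have h2 := abs_lt.1 (Complex.abs_arg_lt_pi_div_two_iff.2 (Or.inl hy))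
  rw [Complex.log_mul hx0 hy0 ⟨by linarith, by linarith⟩]

namespace NearlyLinear

variable {Φ : ℂ → ℂ} {c : ℂ} {r : ℝ}

theorem deriv_reflect (H : NearlyLinear Φ c r) {u : ℂ} (hu : ‖u‖ < 2 * r) :
    HasDerivAt (reflect Φ) (conj (deriv Φ (conj u))) u := by
  have := (H.differentiableAt (x := conj u) (by rwa [Complex.norm_conj])).hasDerivAt.conj_conj
  rw [Complex.conj_conj] at this
  exact this

theorem reflect (H : NearlyLinear Φ c r) : NearlyLinear (reflect Φ) (conj c) r where
  ne_zero := by simpa using H.ne_zero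
  pos := H.pos
  diff u hu := (H.deriv_reflect (by simpa using hu)).differentiableAt.differentiableWithinAt
  approx x hx y hy := by
    have e : _root_.reflect Φ x - _root_.reflect Φ y - conj c * (x - y) =
        conj (Φ (conj x) - Φ (conj y) - c * (conj x - conj y)) := by
      simp [_root_.reflect]
    rw [e, Complex.norm_conj, Complex.norm_conj, ← Complex.norm_conj (x - y), map_sub]
    exact H.approx (conj x) (by simpa using hx) (conj y) (by simpa using hy)

/-- The difference quotient of `Φ`, as an analytic function of two variables. -/
theorem exists_quotient (H : NearlyLinear Φ c r) :
    ∃ q : ℂ × ℂ → ℂ,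
      AnalyticOnNhd ℂ q (Metric.ball 0 (2 * r) ×ˢ Metric.ball 0 (2 * r)) ∧
      ∀ x ∈ Metric.ball (0 : ℂ) (2 * r), ∀ y ∈ Metric.ball (0 : ℂ) (2 * r),
        0 < (q (x, y)).re ∧ (Φ x - Φ y) / c = (x - y) * q (x, y) := by
  have hc := H.ne_zero
  have hcn : 0 < ‖c‖ := norm_pos_iff.2 hc
  set B := Metric.ball (0 : ℂ) (2 * r) with hB
  have hseg : ∀ x ∈ B, ∀ y ∈ B, ∀ t ∈ Set.Icc (0 : ℝ) 1, y + t * (x - y) ∈ B := by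
    intro x hx y hy t ht
    have := (convex_ball (0 : ℂ) (2 * r)).add_smul_sub_mem hy hx ht
    simpa [hB] using this
  have hdd : DifferentiableOn ℂ (deriv Φ) B := H.diff.deriv Metric.isOpen_ball
  -- The mean of `Φ' / c` along the segment from `y` to `x` stays analytic across the diagonal. As
  -- `Φ' / c` is within `1 / 2` of `1`, its real part is at least `1 / 2`.
  refine ⟨fun p => ∫ t in (0 : ℝ)..1, deriv Φ (p.2 + t * (p.1 - p.2)) / c, ?_, ?_⟩
  · refine analyticOnNhd_intervalIntegral 0 1 (Metric.isOpen_ball.prod Metric.isOpen_ball) ?_ ?_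
    · refine ContinuousOn.div_const (H.continuousOn_deriv.comp (by fun_prop) ?_) _
      rintro ⟨⟨x, y⟩, t⟩ ⟨⟨hx, hy⟩, ht⟩
      rw [Set.uIcc_of_le zero_le_one] at ht
      exact hseg x hx y hy t ht
    · rintro t ht ⟨x, y⟩ ⟨hx, hy⟩
      rw [Set.uIcc_of_le zero_le_one] at ht
      simp only [div_eq_mul_inv]
      refine DifferentiableAt.mul_const ?_ _
      exact (hdd.differentiableAt (Metric.isOpen_ball.mem_nhds
        (hseg x hx y hy t ht))).comp (f := fun p : ℂ × ℂ => p.2 + t * (p.1 - p.2)) (x, y)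
        (by fun_prop)
  · intro x hx y hy
    have hci : IntervalIntegrable (fun t : ℝ => deriv Φ (y + t * (x - y)) / c) volume 0 1 := by
      refine ContinuousOn.intervalIntegrable (ContinuousOn.div_const
        (H.continuousOn_deriv.comp (by fun_prop) fun t ht => ?_) _)
      rw [Set.uIcc_of_le zero_le_one] at ht
      exact hseg x hx y hy t ht
    constructor
    · have h1 : ‖∫ t in (0 : ℝ)..1, (deriv Φ (y + t * (x - y)) / c - 1)‖ ≤
          1 / 2 * |(1 : ℝ) - 0| := by
        refine intervalIntegral.norm_integral_le_of_norm_le_const fun t ht => ?_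
        rw [Set.uIoc_of_le zero_le_one] at ht
        have h2 := H.norm_deriv_sub_le (x := y + t * (x - y))
          (by simpa [hB] using hseg x hx y hy t ⟨ht.1.le, ht.2⟩)
        rw [div_sub_one hc, norm_div, div_le_iff₀ hcn]
        linarith
      rw [intervalIntegral.integral_sub hci (by simp)] at h1
      have h3 := (Complex.abs_re_le_norm _).trans h1
      rw [intervalIntegral.integral_const, sub_zero, abs_one, mul_one, one_smul, Complex.sub_re,
        Complex.one_re] at h3
      linarith [(abs_le.1 h3).1]
    · have hFTC := intervalIntegral.integral_eq_sub_of_hasDerivAt (a := 0) (b := 1)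
        (f := fun t : ℝ => Φ (y + t * (x - y)) / c)
        (f' := fun t : ℝ => (x - y) * (deriv Φ (y + t * (x - y)) / c)) (fun t ht => by
          rw [Set.uIcc_of_le zero_le_one] at ht
          have h1 := (H.differentiableAt (x := y + t * (x - y))
            (by simpa [hB] using hseg x hx y hy t ht)).hasDerivAt
          have h2 : HasDerivAt (fun t : ℝ => y + t * (x - y)) (x - y) t := by
            simpa using ((Complex.ofRealCLM.hasDerivAt (x := t)).mul_const (x - y)).const_add y
          have h3 := (HasDerivAt.comp t h1 h2).div_const c
          exact h3.congr_deriv (by ring)) (hci.const_mul _)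
      rw [intervalIntegral.integral_const_mul] at hFTC
      simp only
      rw [hFTC]
      simp [sub_div]

theorem exists_leftInverse (H : NearlyLinear Φ c r) :
    ∃ g : ℂ → ℂ, (∀ ω, ‖ω‖ < 2 * r → g (Φ ω) = ω) ∧
      (∀ s ⊆ Metric.ball 0 (2 * r), IsOpen s → IsOpen (Φ '' s)) ∧
      DifferentiableOn ℂ g (Φ '' Metric.ball 0 (2 * r)) := by
  set B := Metric.ball (0 : ℂ) (2 * r) with hB
  have hinj : Set.InjOn Φ B := fun x hx y hy hxy => by
    by_contra hne
    exact H.ne (by simpa [hB] using hx) (by simpa [hB] using hy) hne (sub_eq_zero.2 hxy)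
  have hmap : ∀ ω ∈ B, map Φ (𝓝 ω) = 𝓝 (Φ ω) := fun ω hω =>
    ((H.diff.analyticAt (Metric.isOpen_ball.mem_nhds hω)).hasStrictDerivAt).map_nhds_eq
      (H.deriv_ne_zero (by simpa [hB] using hω))
  have hg : ∀ ω ∈ B, Function.invFunOn Φ B (Φ ω) = ω := fun ω hω => hinj.leftInvOn_invFunOn hω
  refine ⟨Function.invFunOn Φ B, fun ω hω => hg ω (by simpa [hB] using hω), ?_, ?_⟩
  · intro s hs hso
    rw [isOpen_iff_mem_nhds]
    rintro _ ⟨ω, hω, rfl⟩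
    rw [← hmap ω (hs hω)]
    exact image_mem_map (hso.mem_nhds hω)
  · rintro _ ⟨ω, hω, rfl⟩
    have hev : ∀ᶠ y in 𝓝 ω, Function.invFunOn Φ B (Φ y) = y := by
      filter_upwards [Metric.isOpen_ball.mem_nhds hω] with y hy using hg y hy
    have hcont : ContinuousAt (Function.invFunOn Φ B) (Φ ω) := by
      rw [ContinuousAt, ← hmap ω hω, hg ω hω, tendsto_map'_iff]
      exact tendsto_id.congr' (hev.mono fun y hy => hy.symm)
    have hd : HasDerivAt Φ (deriv Φ ω) (Function.invFunOn Φ B (Φ ω)) := by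
      rw [hg ω hω]
      exact (H.differentiableAt (by simpa [hB] using hω)).hasDerivAt
    refine (HasDerivAt.of_local_left_inverse hcont hd
      (H.deriv_ne_zero (by simpa [hB] using hω)) ?_).differentiableAt.differentiableWithinAt
    rw [← hmap ω hω, eventually_map]
    exact hev.mono fun y hy => by rw [hy]

theorem setIntegral_image (H : NearlyLinear Φ c r) {g : ℂ → ℂ}
    (hg : ContinuousOn g (Φ '' (Set.Icc (-r) r ×ℂ Set.Icc (-r) 0))) :
    ∫ ζ in Φ '' (Set.Ioo (-r) r ×ℂ Set.Ioo (-r) 0), g ζ =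
      ∫ x : ℝ in -r..r, ∫ y : ℝ in -r..0, (Complex.normSq (deriv Φ (x + y * Complex.I)) : ℂ) *
        g (Φ (x + y * Complex.I)) := by
  have hr := H.pos
  have hsub2 : Set.Icc (-r) r ×ℂ Set.Icc (-r) 0 ⊆ Metric.ball 0 (2 * r) := fun ω hω => by
    simpa using norm_lt_of_abs_le hr (abs_le.2 hω.1)
      (abs_le.2 ⟨hω.2.1, hω.2.2.trans hr.le⟩)
  have hsub1 : Set.Ioo (-r) r ×ℂ Set.Ioo (-r) 0 ⊆ Set.Icc (-r) r ×ℂ Set.Icc (-r) 0 :=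
    fun ω hω => ⟨Set.Ioo_subset_Icc_self hω.1, Set.Ioo_subset_Icc_self hω.2⟩
  have hm : MeasurableSet (Set.Ioo (-r) r ×ℂ Set.Ioo (-r) 0) :=
    (isOpen_Ioo.reProdIm isOpen_Ioo).measurableSet
  rw [integral_image_eq_integral_abs_det_fderiv_smul volume hm
    (f' := fun ω => (ContinuousLinearMap.toSpanSingleton ℂ (deriv Φ ω)).restrictScalars ℝ)
    (fun ω hω => ((H.differentiableAt (by
      simpa using hsub2 (hsub1 hω))).hasDerivAt.hasFDerivAt.restrictScalars
        ℝ).hasFDerivWithinAt)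
    (fun x hx y hy hxy => by
      by_contra hne
      exact H.ne (by simpa using hsub2 (hsub1 hx)) (by simpa using hsub2 (hsub1 hy)) hne
        (sub_eq_zero.2 hxy))]
  simp only [det_restrictScalars_toSpanSingleton, abs_of_nonneg (Complex.normSq_nonneg _),
    Complex.real_smul]
  rw [setIntegral_reProdIm hr]
  refine IntegrableOn.mono_set (ContinuousOn.integrableOn_compact
    (isCompact_Icc.reProdIm isCompact_Icc) ?_) hsub1
  refine ContinuousOn.mul ?_ (hg.comp (H.diff.continuousOn.mono hsub2)
    (Set.mapsTo_image _ _))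
  exact (Complex.continuous_ofReal.comp Complex.continuous_normSq).comp_continuousOn
    (H.continuousOn_deriv.mono hsub2)

end NearlyLinear

/-! ### The analytic pieces of the potential -/

theorem continuousOn_cauchyKernel (z w : ℂ) :
    ContinuousOn (cauchyKernel z w) {ζ | ζ ≠ z ∧ ζ ≠ w} := by
  refine continuousOn_const.div ?_ fun ζ hζ => ?_
  · exact (((continuous_id.sub continuous_const).mul
      (Complex.continuous_conj.sub continuous_const))).continuousOn
  · refine mul_ne_zero (sub_ne_zero.2 hζ.1) ?_
    rw [← map_sub]
    exact (map_ne_zero _).2 (sub_ne_zero.2 hζ.2)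

theorem integrableOn_cauchyKernel {Om : Set ℂ} (hBdd : Bornology.IsBounded Om) {z w : ℂ}
    (hz : z ∉ closure Om) (hw : w ∉ closure Om) : IntegrableOn (cauchyKernel z w) Om := by
  refine IntegrableOn.mono_set (ContinuousOn.integrableOn_compact hBdd.isCompact_closure ?_)
    subset_closure
  refine (continuousOn_cauchyKernel z w).mono fun ζ hζ => ⟨?_, ?_⟩
  · rintro rfl; exact hz hζ
  · rintro rfl; exact hw hζ

/-- The contribution to the double Cauchy integral of the points away from an open set `Q` is
analytic on `Q`. -/
theorem analyticOnNhd_setIntegral_diff {Om Q : Set ℂ}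
    (hBdd : Bornology.IsBounded Om) (hQ : IsOpen Q) :
    AnalyticOnNhd ℂ (fun p : ℂ × ℂ => ∫ ζ in Om \ Q, 1 / ((ζ - p.1) * (conj ζ - p.2)))
      (Q ×ˢ {v : ℂ | conj v ∈ Q}) := by
  have hK : IsCompact (closure Om \ Q) := hBdd.isCompact_closure.diff hQ
  have hW : IsOpen (Q ×ˢ {v : ℂ | conj v ∈ Q}) := hQ.prod (hQ.preimage Complex.continuous_conj)
  have hne : ∀ ζ ∈ closure Om \ Q, ∀ p ∈ Q ×ˢ {v : ℂ | conj v ∈ Q},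
      (ζ - p.1) * (conj ζ - p.2) ≠ 0 := by
    rintro ζ ⟨-, hζ⟩ p ⟨hp1, hp2⟩
    refine mul_ne_zero (sub_ne_zero.2 ?_) (sub_ne_zero.2 ?_)
    · rintro rfl; exact hζ hp1
    · intro h
      rw [Set.mem_ofPred_eq, ← h, Complex.conj_conj] at hp2
      exact hζ hp2
  -- `Om \ Q` need not be compact, so the integral is taken over the compact set `closure Om \ Q`
  -- against Lebesgue measure restricted to `Om`.
  have key := analyticOnNhd_setIntegral hK (volume.restrict Om) hW
    (f := fun p ζ => 1 / ((ζ - p.1) * (conj ζ - p.2))) (by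
      refine continuousOn_const.div ?_ fun q hq => hne q.2 hq.2 q.1 hq.1
      have : Continuous fun q : (ℂ × ℂ) × ℂ => conj q.2 :=
        Complex.continuous_conj.comp continuous_snd
      fun_prop) (by
      intro ζ hζ p hp
      have h := hne ζ hζ p hp
      have hd : DifferentiableAt ℂ (fun p : ℂ × ℂ => (ζ - p.1) * (conj ζ - p.2)) p := by fun_prop
      simp only [one_div]
      exact hd.inv h)
  have hset : closure Om \ Q ∩ Om = Om \ Q := by
    ext ζ
    exact ⟨fun h => ⟨h.2, h.1.2⟩, fun h => ⟨⟨subset_closure h.1, h.2⟩, h.1⟩⟩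
  rw [Measure.restrict_restrict hK.measurableSet, hset] at key
  exact key

namespace NearlyLinear

variable {Φ Ψ : ℂ → ℂ} {c d : ℂ} {r : ℝ}

theorem image_reflect (s : ℝ) :
    _root_.reflect Φ '' Metric.ball 0 s = {v | conj v ∈ Φ '' Metric.ball 0 s} := by
  ext v
  constructor
  · rintro ⟨u, hu, rfl⟩
    exact ⟨conj u, by simpa using hu, by simp [_root_.reflect]⟩
  · rintro ⟨u, hu, huv⟩
    exact ⟨conj u, by simpa using hu, by simp [_root_.reflect, huv]⟩

theorem isOpen_image (H : NearlyLinear Φ c r) : IsOpen (Φ '' Metric.ball 0 (r / 3)) := by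
  obtain ⟨g, -, hg, -⟩ := H.exists_leftInverse
  exact hg _ (Metric.ball_subset_ball (by linarith [H.pos])) Metric.isOpen_ball

/-- `κ` is conjugation for the lower sides and the identity for the upper ones, so `κ ω` is never
below the real axis. Points of the sides have norm at least `r`, and parameters come from norm below
`r / 3`, so neither the pole nor the cut is met, even for parameters on the other side of the
boundary. -/
theorem analyticOnNhd_capInt_log (H : NearlyLinear Φ c r) (K : NearlyLinear Ψ d r) {h : ℝ}
    (hh : |h| = r) {κ : ℂ → ℂ} (hκ : Continuous κ) (hκn : ∀ ω, ‖κ ω‖ = ‖ω‖)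
    (hκi : ∀ ω ∈ capSet r h, 0 ≤ (κ ω).im) :
    AnalyticOnNhd ℂ (fun p : ℂ × ℂ => capInt r h (fun ω => deriv Φ ω / (Φ ω - p.1) *
        Complex.log (-Complex.I * ((Ψ (κ ω) - p.2) / d))))
      ((Φ '' Metric.ball 0 (r / 3)) ×ˢ (Ψ '' Metric.ball 0 (r / 3))) := by
  have hr := H.pos
  have hn : ∀ ω ∈ capSet r h, r ≤ ‖ω‖ ∧ ‖ω‖ < 2 * r := fun ω hω =>
    norm_mem_of_mem_capSet hr hh hω
  have hne : ∀ ω ∈ capSet r h, ∀ z ∈ Φ '' Metric.ball 0 (r / 3), Φ ω - z ≠ 0 := by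
    rintro ω hω _ ⟨α, hα, rfl⟩
    have hα' : ‖α‖ < r / 3 := by simpa using hα
    refine H.ne (hn ω hω).2 (by linarith) fun he => ?_
    rw [← he] at hα'
    linarith [(hn ω hω).1]
  have hsl : ∀ ω ∈ capSet r h, ∀ v ∈ Ψ '' Metric.ball 0 (r / 3),
      -Complex.I * ((Ψ (κ ω) - v) / d) ∈ Complex.slitPlane := by
    rintro ω hω _ ⟨b, hb, rfl⟩
    have hb' : ‖b‖ < r / 3 := by simpa using hb
    refine K.mem_slitPlane_of_norm_lt (by rw [hκn]; exact (hn ω hω).2) ?_ (hκi ω hω)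
    rw [hκn]
    linarith [(hn ω hω).1]
  have hcap : capSet r h ⊆ Metric.ball 0 (2 * r) := fun ω hω => by simpa using (hn ω hω).2
  refine analyticOnNhd_capInt hr.le (H.isOpen_image.prod K.isOpen_image) ?_ ?_
  · have h1 : ContinuousOn (fun q : (ℂ × ℂ) × ℂ => deriv Φ q.2)
        (((Φ '' Metric.ball 0 (r / 3)) ×ˢ (Ψ '' Metric.ball 0 (r / 3))) ×ˢ capSet r h) :=
      H.continuousOn_deriv.comp continuousOn_snd fun q hq => hcap hq.2
    have h2 : ContinuousOn (fun q : (ℂ × ℂ) × ℂ => Φ q.2)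
        (((Φ '' Metric.ball 0 (r / 3)) ×ˢ (Ψ '' Metric.ball 0 (r / 3))) ×ˢ capSet r h) :=
      H.diff.continuousOn.comp continuousOn_snd fun q hq => hcap hq.2
    have h3 : ContinuousOn (fun q : (ℂ × ℂ) × ℂ => Ψ (κ q.2))
        (((Φ '' Metric.ball 0 (r / 3)) ×ˢ (Ψ '' Metric.ball 0 (r / 3))) ×ˢ capSet r h) :=
      K.diff.continuousOn.comp (hκ.comp continuous_snd).continuousOn fun q hq => by
        simpa [hκn] using hcap hq.2
    refine ContinuousOn.mul (h1.div (h2.sub (by fun_prop)) ?_) (ContinuousOn.clog ?_ ?_)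
    · exact fun q hq => hne _ hq.2 _ hq.1.1
    · exact continuousOn_const.mul ((h3.sub (by fun_prop)).div_const _)
    · exact fun q hq => hsl _ hq.2 _ hq.1.2
  · intro ω hω p hp
    have h1 : DifferentiableAt ℂ (fun q : ℂ × ℂ => Φ ω - q.1) p := by fun_prop
    have h2 : DifferentiableAt ℂ (fun q : ℂ × ℂ => -Complex.I * ((Ψ (κ ω) - q.2) / d)) p := by
      simp only [div_eq_mul_inv]
      fun_prop
    refine DifferentiableAt.mul ?_ (h2.clog (hsl ω hω _ hp.2))
    simp only [div_eq_mul_inv]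
    exact (h1.inv (hne ω hω _ hp.1)).const_mul _

/-- The two ways of measuring the distance to the reflected point differ by an analytic unit. -/
theorem exists_log_sub_log (H : NearlyLinear Φ c r) (K : NearlyLinear Ψ d r) :
    ∃ m : ℂ × ℂ → ℂ, AnalyticOnNhd ℂ m (Metric.ball 0 (2 * r) ×ˢ Metric.ball 0 (2 * r)) ∧
      ∀ x ∈ Metric.ball (0 : ℂ) (2 * r), ∀ y ∈ Metric.ball (0 : ℂ) (2 * r), y.im < x.im →
        Complex.log (-Complex.I * ((Ψ x - Ψ y) / d)) =
          Complex.log (-Complex.I * ((Φ x - Φ y) / c)) + m (x, y) := by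
  obtain ⟨q, hq, hq'⟩ := H.exists_quotient
  obtain ⟨q₁, hq₁, hq₁'⟩ := K.exists_quotient
  refine ⟨fun p => Complex.log (q₁ p) - Complex.log (q p), ?_, ?_⟩
  · intro p hp
    exact ((hq₁ p hp).clog (Or.inl (hq₁' p.1 hp.1 p.2 hp.2).1)).sub
      ((hq p hp).clog (Or.inl (hq' p.1 hp.1 p.2 hp.2).1))
  · intro x hx y hy hxy
    have hre : 0 < (-Complex.I * (x - y)).re := by simpa using hxy
    rw [(hq' x hx y hy).2, (hq₁' x hx y hy).2, ← mul_assoc, ← mul_assoc,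
      log_mul_of_re_pos hre (hq' x hx y hy).1, log_mul_of_re_pos hre (hq₁' x hx y hy).1]
    ring

/-- This explains the angle `arg (I * c)`: when `x` is above `y`, `Φ x - Φ y` is comparable to `c *
(x - y)`, and the rotation taking `I * c` to the positive axis brings it into the slit plane. -/
theorem exp_arg_mul (hc : c ≠ 0) (x : ℂ) :
    Complex.exp (-((Complex.arg (Complex.I * c) : ℂ) * Complex.I)) * x =
      (‖c‖ : ℝ) * (-Complex.I * (x / c)) := by
  have h := Complex.norm_mul_exp_arg_mul_I (Complex.I * c)
  have hc' : (‖c‖ : ℂ) ≠ 0 := by simpa using hc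
  rw [norm_mul, Complex.norm_I, one_mul] at h
  rw [Complex.exp_neg]
  have hE : Complex.exp ((Complex.arg (Complex.I * c) : ℂ) * Complex.I) =
      Complex.I * c / ‖c‖ := by
    rw [eq_div_iff hc', mul_comm]
    exact h
  rw [hE]
  have := Complex.I_ne_zero
  field_simp
  rw [Complex.I_sq]
  ring

theorem logBranch_eq (H : NearlyLinear Φ c r) {x y : ℂ} (hx : ‖x‖ < 2 * r) (hy : ‖y‖ < 2 * r)
    (hxy : y.im < x.im) :
    Φ x - Φ y ∈ cutPlane (Complex.arg (Complex.I * c)) ∧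
      logBranch (Complex.arg (Complex.I * c)) (Φ x - Φ y) =
        Complex.log (-Complex.I * ((Φ x - Φ y) / c)) +
          (Real.log ‖c‖ + Complex.arg (Complex.I * c) * Complex.I) := by
  have hs := H.mem_slitPlane_of_im_lt hx hy hxy
  have hc : 0 < ‖c‖ := norm_pos_iff.2 H.ne_zero
  constructor
  · rw [cutPlane, Set.mem_ofPred_eq, exp_arg_mul H.ne_zero]
    rw [Complex.mem_slitPlane_iff] at hs ⊢
    rw [Complex.re_ofReal_mul, Complex.im_ofReal_mul]
    rcases hs with hs | hs
    · exact Or.inl (mul_pos hc hs)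
    · exact Or.inr (mul_ne_zero hc.ne' hs)
  · rw [logBranch, exp_arg_mul H.ne_zero, Complex.log_ofReal_mul hc (Complex.slitPlane_ne_zero hs)]
    ring

theorem inter_image {Om : Set ℂ} (hr : 0 < r)
    (hlow : ∀ ω : ℂ, ‖ω‖ < 2 * r → ω.im < 0 → Φ ω ∈ Om)
    (hup : ∀ ω : ℂ, ‖ω‖ < 2 * r → 0 ≤ ω.im → Φ ω ∉ Om) :
    Om ∩ Φ '' (Set.Ioo (-r) r ×ℂ Set.Ioo (-r) r) =
      Φ '' (Set.Ioo (-r) r ×ℂ Set.Ioo (-r) 0) := by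
  have hn : ∀ ω ∈ Set.Ioo (-r) r ×ℂ Set.Ioo (-r) r, ‖ω‖ < 2 * r := fun ω hω =>
    norm_lt_of_abs_le hr (abs_lt.2 hω.1).le (abs_lt.2 hω.2).le
  apply Set.Subset.antisymm
  · rintro _ ⟨hO, ω, hω, rfl⟩
    refine ⟨ω, ⟨hω.1, hω.2.1, ?_⟩, rfl⟩
    by_contra h
    exact hup ω (hn ω hω) (not_lt.1 h) hO
  · rintro _ ⟨ω, hω, rfl⟩
    have hω' : ω ∈ Set.Ioo (-r) r ×ℂ Set.Ioo (-r) r := ⟨hω.1, hω.2.1, hω.2.2.trans hr⟩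
    exact ⟨hlow ω (hn ω hω') hω.2.2, ω, hω', rfl⟩

/-- The local formula in the chart: `conj β` is the parameter of the reflected point, and it plays
the part of `b` in the integral over the half-square. -/
theorem exists_logPotential_eq (H : NearlyLinear Φ c r) {Om : Set ℂ}
    (hBdd : Bornology.IsBounded Om)
    (hlow : ∀ ω : ℂ, ‖ω‖ < 2 * r → ω.im < 0 → Φ ω ∈ Om)
    (hup : ∀ ω : ℂ, ‖ω‖ < 2 * r → 0 ≤ ω.im → Φ ω ∉ Om)
    (hup' : ∀ ω : ℂ, ‖ω‖ < 2 * r → 0 < ω.im → Φ ω ∉ closure Om) :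
    ∃ (θ : ℝ) (a : ℂ × ℂ → ℂ),
      AnalyticOnNhd ℂ a ((Φ '' Metric.ball 0 (r / 3)) ×ˢ
        {v : ℂ | conj v ∈ Φ '' Metric.ball 0 (r / 3)}) ∧
      ∀ α β : ℂ, ‖α‖ < r / 3 → ‖β‖ < r / 3 → 0 < α.im → 0 < β.im →
        Φ α - Φ (conj β) ∈ cutPlane θ ∧
        logPotential Om (Φ α) (Φ β) =
          logBranch θ (Φ α - Φ (conj β)) + a (Φ α, conj (Φ β)) := by
  have hr := H.pos
  have hK := H.reflect
  set Ψ := _root_.reflect Φ with hΨ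
  set U := Φ '' Metric.ball 0 (r / 3) with hU
  set Q := Φ '' (Set.Ioo (-r) r ×ℂ Set.Ioo (-r) r) with hQ
  set S := Φ '' (Set.Ioo (-r) r ×ℂ Set.Ioo (-r) 0) with hS
  obtain ⟨g, hg, hgo, hgd⟩ := H.exists_leftInverse
  have hb3 : Metric.ball (0 : ℂ) (r / 3) ⊆ Metric.ball 0 (2 * r) :=
    Metric.ball_subset_ball (by linarith)
  have hUo : IsOpen U := H.isOpen_image
  have hQo : IsOpen Q := hgo _ (fun ω hω => by
    simpa using norm_lt_of_abs_le hr (abs_lt.2 hω.1).le (abs_lt.2 hω.2).le)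
    (isOpen_Ioo.reProdIm isOpen_Ioo)
  have hUQ : U ⊆ Q := by
    refine Set.image_mono fun ω hω => ?_
    have hω' : ‖ω‖ < r / 3 := by simpa using hω
    exact ⟨abs_lt.1 (by linarith [Complex.abs_re_le_norm ω]),
      abs_lt.1 (by linarith [Complex.abs_im_le_norm ω])⟩
  have hVo : IsOpen {v : ℂ | conj v ∈ U} := hUo.preimage Complex.continuous_conj
  obtain ⟨m, hm, hm'⟩ := H.exists_log_sub_log hK
  let outer : ℂ × ℂ → ℂ := fun p => ∫ ζ in Om \ Q, 1 / ((ζ - p.1) * (conj ζ - p.2))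
  let low : ℂ × ℂ → ℂ := fun p => capInt r (-r) (fun ω => deriv Φ ω / (Φ ω - p.1) *
        Complex.log (-Complex.I * ((Ψ (conj ω) - p.2) / conj c)))
  let up : ℂ × ℂ → ℂ := fun p => capInt r r (fun ω => deriv Φ ω / (Φ ω - p.1) *
        Complex.log (-Complex.I * ((Ψ ω - p.2) / conj c)))
  have hlowA : AnalyticOnNhd ℂ low (U ×ˢ {v : ℂ | conj v ∈ U}) := by
    rw [hU, ← image_reflect]
    refine H.analyticOnNhd_capInt_log hK (by rw [abs_neg, abs_of_pos hr])
      Complex.continuous_conj Complex.norm_conj fun ω hω => ?_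
    have := hω.1
    rw [Set.uIcc_of_ge (by linarith)] at this
    rw [Complex.conj_im]
    linarith [this.2]
  have hupA : AnalyticOnNhd ℂ up (U ×ˢ {v : ℂ | conj v ∈ U}) := by
    rw [hU, ← image_reflect]
    refine H.analyticOnNhd_capInt_log hK (abs_of_pos hr) (κ := id)
      continuous_id (fun _ => rfl) fun ω hω => ?_
    have := hω.1
    rw [Set.uIcc_of_le hr.le] at this
    exact this.1
  have houterA : AnalyticOnNhd ℂ outer (U ×ˢ {v : ℂ | conj v ∈ U}) :=
    (analyticOnNhd_setIntegral_diff hBdd hQo).mono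
      (Set.prod_mono hUQ fun v hv => hUQ hv)
  have hgU : AnalyticOnNhd ℂ g U := (hgd.mono (Set.image_mono hb3)).analyticOnNhd hUo
  have hgV : AnalyticOnNhd ℂ (fun v => conj (g (conj v))) {v : ℂ | conj v ∈ U} := by
    refine DifferentiableOn.analyticOnNhd (fun v hv => ?_) hVo
    have h := (hgU _ hv).differentiableAt.conj_conj
    rw [Complex.conj_conj] at h
    exact h.differentiableWithinAt
  have hgm : ∀ z ∈ U, g z ∈ Metric.ball (0 : ℂ) (2 * r) := by
    rintro _ ⟨α, hα, rfl⟩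
    rw [hg α (by simpa using hb3 hα)]
    exact hb3 hα
  have hmA : AnalyticOnNhd ℂ (fun p : ℂ × ℂ => m (g p.1, conj (g (conj p.2))))
      (U ×ˢ {v : ℂ | conj v ∈ U}) := by
    intro p hp
    have h1 : AnalyticAt ℂ (fun p : ℂ × ℂ => g p.1) p :=
      (hgU p.1 hp.1).fun_comp (f := Prod.fst) analyticAt_fst
    have h2 : AnalyticAt ℂ (fun p : ℂ × ℂ => conj (g (conj p.2))) p :=
      (hgV p.2 hp.2).fun_comp (g := fun v => conj (g (conj v))) (f := Prod.snd) analyticAt_snd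
    refine (hm (g p.1, conj (g (conj p.2))) ⟨hgm _ hp.1, ?_⟩).fun_comp
      (f := fun p : ℂ × ℂ => (g p.1, conj (g (conj p.2)))) (h1.prod h2)
    have := hgm _ hp.2
    simpa using this
  -- The prefactor times `2 I` is `-1 / π`, which weights `outer`. The half-square gives `low - up -
  -- 2πi log`, weighted by `-1 / (2πi)`. The last two terms change `Ψ` to `Φ` in the logarithm and
  -- pass to `logBranch`.
  refine ⟨Complex.arg (Complex.I * c), fun p =>
    (-1 / Real.pi : ℂ) * outer p + (-1 / (2 * Real.pi * Complex.I) : ℂ) * (low p - up p) +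
      m (g p.1, conj (g (conj p.2))) -
      (Real.log ‖c‖ + Complex.arg (Complex.I * c) * Complex.I), ?_, ?_⟩
  · exact (((analyticOnNhd_const.mul houterA).add
      (analyticOnNhd_const.mul (hlowA.sub hupA))).add hmA).sub analyticOnNhd_const
  · intro α β hα hβ hα0 hβ0
    have hα2 : ‖α‖ < 2 * r := by linarith
    have hβ2 : ‖β‖ < 2 * r := by linarith
    have hb : ‖conj β‖ < r / 3 := by rwa [Complex.norm_conj]
    have hb2 : ‖conj β‖ < 2 * r := by linarith
    have hb0 : (conj β).im < 0 := by simpa using hβ0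
    obtain ⟨hcut, hbr⟩ := H.logBranch_eq hα2 hb2 (hb0.trans hα0)
    refine ⟨hcut, ?_⟩
    have hΨb : Ψ (conj β) = conj (Φ β) := by simp [hΨ, _root_.reflect]
    have hker := integrableOn_cauchyKernel hBdd (hup' α hα2 hα0) (hup' β hβ2 hβ0)
    have hsplit : ∫ ζ in Om, cauchyKernel (Φ α) (Φ β) ζ =
        (∫ ζ in S, cauchyKernel (Φ α) (Φ β) ζ) + outer (Φ α, conj (Φ β)) := by
      rw [← integral_inter_add_sdiff hQo.measurableSet hker, inter_image hr hlow hup]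
      rfl
    -- The Jacobian `|Φ'|²` is `Φ'` times its conjugate; one factor goes to each half of the kernel,
    -- leaving a holomorphic times an antiholomorphic function.
    have hinner : ∫ ζ in S, cauchyKernel (Φ α) (Φ β) ζ =
        ∫ x : ℝ in -r..r, ∫ y : ℝ in -r..0,
          deriv Φ (x + y * Complex.I) / (Φ (x + y * Complex.I) - Φ α) *
          (deriv Ψ (conj (x + y * Complex.I)) /
            (Ψ (conj (x + y * Complex.I)) - Ψ (conj β))) := by
      rw [hS, H.setIntegral_image]
      · refine intervalIntegral.integral_congr fun x hx => ?_
        refine intervalIntegral.integral_congr fun y hy => ?_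
        rw [Set.uIcc_of_le (by linarith)] at hx hy
        have hn : ‖(x + y * Complex.I : ℂ)‖ < 2 * r := norm_lt_of_abs_le hr
          (by simpa using abs_le.2 hx) (by simpa using abs_le.2 ⟨hy.1, hy.2.trans hr.le⟩)
        generalize (x + y * Complex.I : ℂ) = ω at hn
        have hd := (H.deriv_reflect (u := conj ω) (by rwa [Complex.norm_conj])).deriv
        rw [Complex.conj_conj] at hd
        simp only [cauchyKernel]
        rw [hd, hΨb, hΨ, _root_.reflect, Complex.conj_conj, ← Complex.mul_conj, one_div, mul_inv]
        ring
      · refine (continuousOn_cauchyKernel _ _).mono ?_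
        rintro _ ⟨ω, hω, rfl⟩
        have hn : ‖ω‖ < 2 * r := norm_lt_of_abs_le hr (abs_le.2 hω.1)
          (abs_le.2 ⟨hω.2.1, hω.2.2.trans hr.le⟩)
        have him : ω.im ≤ 0 := hω.2.2
        exact ⟨sub_ne_zero.1 (H.ne hn hα2 fun h => by rw [h] at him; linarith),
          sub_ne_zero.1 (H.ne hn hβ2 fun h => by rw [h] at him; linarith)⟩
    have hcore := H.integral_lower_half hK hα hb hα0 hb0
    rw [← hinner] at hcore
    have hlog := hm' α (by simpa using hα2) (conj β) (by simpa using hβ2) (hb0.trans hα0)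
    have hlowe : low (Φ α, conj (Φ β)) = capInt r (-r) (fun ω => deriv Φ ω / (Φ ω - Φ α) *
        Complex.log (-Complex.I * ((Ψ (conj ω) - Ψ (conj β)) / conj c))) := by
      rw [hΨb]
    have hupe : up (Φ α, conj (Φ β)) = capInt r r (fun ω => deriv Φ ω / (Φ ω - Φ α) *
        Complex.log (-Complex.I * ((Ψ ω - Ψ (conj β)) / conj c))) := by
      rw [hΨb]
    rw [← hlowe, ← hupe, hlog] at hcore
    simp only [Complex.conj_conj, hg α hα2, hg β hβ2]
    rw [logPotential, integralConjWedge, integral_mul_const, hsplit, hbr]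
    generalize Complex.log (-Complex.I * ((Φ α - Φ (conj β)) / c)) = X at hcore ⊢
    have hpi : (Real.pi : ℂ) ≠ 0 := by exact_mod_cast Real.pi_ne_zero
    have hI := Complex.I_ne_zero
    field_simp
    linear_combination -hcore

end NearlyLinear

/-! ### Shrinking the chart, the sides of the boundary, and the conclusion -/

theorem exists_nearlyLinear {Φ : ℂ → ℂ} (hΦ : AnalyticAt ℂ Φ 0) (hd : deriv Φ 0 ≠ 0)
    {P : ℂ → Prop} (hP : ∀ᶠ ω in 𝓝 0, P ω) :
    ∃ r, NearlyLinear Φ (deriv Φ 0) r ∧ ∀ ω, ‖ω‖ < 2 * r → P ω := by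
  have hc : 0 < ‖deriv Φ 0‖ / 2 := half_pos (norm_pos_iff.2 hd)
  have h1 := hΦ.hasStrictDerivAt.hasStrictFDerivAt.isLittleO.def hc
  obtain ⟨ε, hε, hball⟩ := Metric.eventually_nhds_iff_ball.1 h1
  obtain ⟨δ, hδ, hball'⟩ := Metric.eventually_nhds_iff_ball.1 (hΦ.eventually_analyticAt.and hP)
  have hsub : 2 * (min ε δ / 2) = min ε δ := by ring
  refine ⟨min ε δ / 2, ⟨hd, by positivity, ?_, ?_⟩, ?_⟩ <;> rw [hsub]
  · intro ω hω
    exact (hball' ω (Metric.ball_subset_ball (min_le_right _ _)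
      hω)).1.differentiableAt.differentiableWithinAt
  · intro x hx y hy
    have := hball (x, y) (by
      rw [← ball_prod_same]
      exact ⟨Metric.ball_subset_ball (min_le_left _ _) hx,
        Metric.ball_subset_ball (min_le_left _ _) hy⟩)
    simpa [mul_comm] using this
  · intro ω hω
    exact (hball' ω (by simpa using hω.trans_le (min_le_right _ _))).2

theorem IsPreconnected.subset_or_disjoint_closure {Om T : Set ℂ} (hT : IsPreconnected T)
    (hOpen : IsOpen Om) (hfr : Disjoint T (frontier Om)) : T ⊆ Om ∨ T ⊆ (closure Om)ᶜ := by
  refine hT.subset_or_subset hOpen isClosed_closure.isOpen_compl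
    (Set.disjoint_compl_right_iff_subset.2 subset_closure) fun x hx => ?_
  by_contra h
  rw [Set.mem_union, not_or, Set.notMem_compl_iff] at h
  refine hfr.le_bot ⟨hx, ?_⟩
  rw [hOpen.frontier_eq]
  exact ⟨h.2, h.1⟩

namespace NearlyLinear

variable {Φ : ℂ → ℂ} {c : ℂ} {r : ℝ} {Om : Set ℂ}

/-- The half-turn preserves the real axis and swaps the half-discs, so it can be assumed that `Om`
lies below. -/
theorem comp_neg (H : NearlyLinear Φ c r) : NearlyLinear (fun ω => Φ (-ω)) (-c) r where
  ne_zero := neg_ne_zero.2 H.ne_zero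
  pos := H.pos
  diff := H.diff.comp (by fun_prop) fun ω hω => by simpa using hω
  approx x hx y hy := by
    have := H.approx (-x) (by simpa using hx) (-y) (by simpa using hy)
    have e : -x - -y = -(x - y) := by ring
    rw [e, norm_neg, mul_neg, ← neg_mul] at this
    rwa [norm_neg]

/-- Conjugation is transported by the chart: the conjugate of `Φ (conj (g w))` is `reflect Φ (g w)`,
which is holomorphic in `w`. -/
theorem exists_isSchwarzReflection (H : NearlyLinear Φ c r)
    (hfr : ∀ ω : ℂ, ‖ω‖ < 2 * r → (Φ ω ∈ frontier Om ↔ ω.im = 0)) :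
    ∃ sig : ℂ → ℂ, IsSchwarzReflection (frontier Om) (Φ '' Metric.ball 0 (r / 3)) sig ∧
      ∀ ω : ℂ, ‖ω‖ < r / 3 → sig (Φ ω) = Φ (conj ω) := by
  have hr := H.pos
  have hb3 : Metric.ball (0 : ℂ) (r / 3) ⊆ Metric.ball 0 (2 * r) :=
    Metric.ball_subset_ball (by linarith)
  obtain ⟨g, hg, -, hgd⟩ := H.exists_leftInverse
  have hsig : ∀ ω : ℂ, ‖ω‖ < r / 3 → Φ (conj (g (Φ ω))) = Φ (conj ω) := fun ω hω => by
    rw [hg ω (by linarith)]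
  refine ⟨fun w => Φ (conj (g w)), ⟨H.isOpen_image, ?_, ?_, ?_⟩, hsig⟩
  · exact ((convex_ball (0 : ℂ) (r / 3)).isConnected (Metric.nonempty_ball.2 (by linarith))).image
      Φ (H.diff.continuousOn.mono hb3)
  · refine DifferentiableOn.analyticOnNhd ?_ H.isOpen_image
    refine H.reflect.diff.comp (hgd.mono (Set.image_mono hb3)) ?_
    rintro _ ⟨ω, hω, rfl⟩
    rw [hg ω (by simpa using hb3 hω)]
    exact hb3 hω
  · rintro _ ⟨hw, ω, hω, rfl⟩
    have hω' : ‖ω‖ < r / 3 := by simpa using hω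
    have him := (hfr ω (by linarith)).1 hw
    rw [hsig ω hω', Complex.conj_eq_iff_im.2 him]

theorem subset_or_disjoint_closure (H : NearlyLinear Φ c r) (hOpen : IsOpen Om)
    (hfr : ∀ ω : ℂ, ‖ω‖ < 2 * r → (Φ ω ∈ frontier Om ↔ ω.im = 0)) :
    (∀ ω : ℂ, ‖ω‖ < 2 * r → ω.im < 0 → Φ ω ∈ Om) ∨
      ∀ ω : ℂ, ‖ω‖ < 2 * r → ω.im < 0 → Φ ω ∉ closure Om := by
  have hconv : Convex ℝ (Metric.ball (0 : ℂ) (2 * r) ∩ {ω | ω.im < 0}) :=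
    (convex_ball _ _).inter (convex_halfSpace_im_lt 0)
  have hpre := hconv.isPreconnected.image Φ (H.diff.continuousOn.mono Set.inter_subset_left)
  rcases hpre.subset_or_disjoint_closure hOpen (by
    rw [Set.disjoint_left]
    rintro _ ⟨ω, ⟨hω, him⟩, rfl⟩ h
    exact him.ne ((hfr ω (by simpa using hω)).1 h)) with h | h
  · exact Or.inl fun ω hω him => h ⟨ω, ⟨by simpa using hω, him⟩, rfl⟩
  · exact Or.inr fun ω hω him => h ⟨ω, ⟨by simpa using hω, him⟩, rfl⟩

theorem exists_logPotential_eq_logBranch_add (H : NearlyLinear Φ c r) (hOpen : IsOpen Om)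
    (hBdd : Bornology.IsBounded Om)
    (hfr : ∀ ω : ℂ, ‖ω‖ < 2 * r → (Φ ω ∈ frontier Om ↔ ω.im = 0))
    (hlow : ∀ ω : ℂ, ‖ω‖ < 2 * r → ω.im < 0 → Φ ω ∈ Om)
    (hup : ∀ ω : ℂ, ‖ω‖ < 2 * r → 0 < ω.im → Φ ω ∉ closure Om) :
    ∃ (U : Set ℂ) (sig : ℂ → ℂ) (θ : ℝ) (a : ℂ × ℂ → ℂ),
      Φ 0 ∈ U ∧ IsSchwarzReflection (frontier Om) U sig ∧
      AnalyticOnNhd ℂ a (U ×ˢ {v : ℂ | conj v ∈ U}) ∧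
      ∀ z ∈ U \ closure Om, ∀ w ∈ U \ closure Om,
        IntegrableOn (cauchyKernel z w) Om ∧
        z - sig w ∈ cutPlane θ ∧
        logPotential Om z w = logBranch θ (z - sig w) + a (z, conj w) := by
  have hr := H.pos
  obtain ⟨sig, hsig, hsig'⟩ := H.exists_isSchwarzReflection hfr
  obtain ⟨θ, a, ha, hmain⟩ := H.exists_logPotential_eq hBdd hlow
    (fun ω hω him => by
      rcases him.eq_or_lt with h | h
      · have := (hfr ω hω).2 h.symm
        rw [hOpen.frontier_eq] at this
        exact this.2
      · exact fun h' => hup ω hω h (subset_closure h')) hup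
  have him : ∀ ω ∈ Metric.ball (0 : ℂ) (r / 3), Φ ω ∉ closure Om → ‖ω‖ < r / 3 ∧ 0 < ω.im := by
    intro ω hω h
    have hω' : ‖ω‖ < r / 3 := by simpa using hω
    refine ⟨hω', ?_⟩
    by_contra hn
    rcases (not_lt.1 hn).eq_or_lt with h0 | h0
    · exact h (frontier_subset_closure ((hfr ω (by linarith)).2 h0))
    · exact h (subset_closure (hlow ω (by linarith) h0))
  refine ⟨Φ '' Metric.ball 0 (r / 3), sig, θ, a, ⟨0, by simpa using hr, rfl⟩, hsig, ha, ?_⟩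
  rintro _ ⟨⟨α, hα, rfl⟩, hz⟩ _ ⟨⟨β, hβ, rfl⟩, hw⟩
  obtain ⟨hα, hα0⟩ := him α hα hz
  obtain ⟨hβ, hβ0⟩ := him β hβ hw
  rw [hsig' β hβ]
  exact ⟨integrableOn_cauchyKernel hBdd hz hw, hmain α β hα hβ hα0 hβ0⟩

end NearlyLinear

end

theorem corollary3p4 (Om : Set ℂ) (hOpen : IsOpen Om) (hConn : IsConnected Om)
    (hBdd : Bornology.IsBounded Om) (lam : ℂ) (hlam : IsSmoothAnalyticBoundaryPoint Om lam) :
    ∃ (U : Set ℂ) (sig : ℂ → ℂ) (θ : ℝ) (a : ℂ × ℂ → ℂ),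
      lam ∈ U ∧ IsSchwarzReflection (frontier Om) U sig ∧
      AnalyticOnNhd ℂ a (U ×ˢ {v : ℂ | conj v ∈ U}) ∧
      ∀ z ∈ U \ closure Om, ∀ w ∈ U \ closure Om,
        IntegrableOn (cauchyKernel z w) Om ∧
        z - sig w ∈ cutPlane θ ∧
        logPotential Om z w = logBranch θ (z - sig w) + a (z, conj w) := by
  obtain ⟨Φ, hΦ, rfl, hd, hev⟩ := exists_boundary_chart hlam
  obtain ⟨r, H, hfr⟩ := exists_nearlyLinear hΦ hd hev
  have hr := H.pos
  have hfr' : ∀ ω : ℂ, ‖ω‖ < 2 * r → (Φ (-ω) ∈ frontier Om ↔ ω.im = 0) := fun ω hω => by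
    simpa using hfr (-ω) (by simpa using hω)
  have hneg : ∀ {P : ℂ → Prop}, (∀ ω : ℂ, ‖ω‖ < 2 * r → ω.im < 0 → P (Φ (-ω))) →
      ∀ ω : ℂ, ‖ω‖ < 2 * r → 0 < ω.im → P (Φ ω) := fun h ω hω him => by
    simpa using h (-ω) (by simpa using hω) (by simpa using him)
  rcases H.subset_or_disjoint_closure hOpen hfr with hl | hl <;>
    rcases H.comp_neg.subset_or_disjoint_closure hOpen hfr' with hu | hu
  -- `Om` lies on both sides of the curve, so `U \ closure Om` is empty and any `θ` and `a` will do.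
  · obtain ⟨sig, hsig, -⟩ := H.exists_isSchwarzReflection hfr
    have hu' := hneg (P := fun z => z ∈ Om) hu
    refine ⟨Φ '' Metric.ball 0 (r / 3), sig, 0, 0, ⟨0, by simpa using hr, rfl⟩, hsig,
      analyticOnNhd_const, ?_⟩
    rintro _ ⟨⟨ω, hω, rfl⟩, hz⟩
    have hω' : ‖ω‖ < r / 3 := by simpa using hω
    have hω2 : ‖ω‖ < 2 * r := by linarith
    exfalso
    rcases lt_trichotomy ω.im 0 with h | h | h
    · exact hz (subset_closure (hl ω hω2 h))
    · exact hz (frontier_subset_closure ((hfr ω hω2).2 h))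
    · exact hz (subset_closure (hu' ω hω2 h))
  · exact H.exists_logPotential_eq_logBranch_add hOpen hBdd hfr hl
      (hneg (P := fun z => z ∉ closure Om) hu)
  · have := H.comp_neg.exists_logPotential_eq_logBranch_add hOpen hBdd hfr' hu fun ω hω him =>
      hl (-ω) (by simpa using hω) (by simpa using him)
    simpa only [neg_zero] using this
  -- With both sides outside `closure Om`, the open set `Om` would miss a neighbourhood of its own
  -- boundary point.
  · exfalso
    have hu' := hneg (P := fun z => z ∉ closure Om) hu
    have hcl : Φ 0 ∈ closure Om := frontier_subset_closure hlam.1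
    obtain ⟨_, ⟨ω, hω, rfl⟩, hO⟩ := mem_closure_iff.1 hcl _ H.isOpen_image
      ⟨0, by simpa using hr, rfl⟩
    have hω' : ‖ω‖ < r / 3 := by simpa using hω
    have hω2 : ‖ω‖ < 2 * r := by linarith
    rcases lt_trichotomy ω.im 0 with h | h | h
    · exact hl ω hω2 h (subset_closure hO)
    · have := (hfr ω hω2).2 h
      rw [hOpen.frontier_eq] at this
      exact this.2 hO
    · exact hu' ω hω2 h (subset_closure hO)
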